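/- Let $F\subset\mathbb R$ be a closed set, $0<\alpha\le 1$ and $l\in\mathbb R$. **Staircase function.** For a subdivision $P=\{x=x_0,\dots,x_n=y\}$ of $[x,y]$ put $\sigma^\alpha[F,P]=\sum_{i<n}\frac{(x_{i+1}-x_i)^\alpha}{\Gamma(\alpha+1)}\Theta(F,[x_i,x_{i+1}])$, where $\Theta(F,I)=1$ if $F\cap I\ne\emptyset$ and $\Theta(F,I)=0$ otherwise; let $\gamma^\alpha(F,x,y)=\lim_{\delta\to0}\inf_{|P|\le\delta}\sigma^\alpha[F,P]\in[0,\infty]$, and let $S(x)=S_F^\alpha(x)=\gamma^\alpha(F,l,x)$ for $x\ge l$ and $S(x)=-\gamma^\alpha(F,x,l)$ for $x<l$. Assume that $\gamma^\alpha(F,x,y)<\infty$ for all $x\le y$, that $S(0)=0$, and that $S(t)\to\infty$ as $t\to\infty$. **Integral.** A function $h$ is $F^\alpha$-integrable over $[a,b]$ if it is bounded on $F\cap[a,b]$ and $\sup_P\sum_i m_i\,(S(x_{i+1})-S(x_i))=\inf_P\sum_i M_i\,(S(x_{i+1})-S(x_i))$, where $P$ runs over the subdivisions of $[a,b]$ and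 $m_i,M_i$ are the infimum and the supremum of $h$ over $F\cap[x_i,x_{i+1}]$ ($0$ if this set is empty); the common value is $\int_a^b h(t)\,d_F^\alpha t$. Moreover $\int_0^\infty h(t)\,d_F^\alpha t=\lim_{b\to\infty}\int_0^b h(t)\,d_F^\alpha t$, which exists if $h$ is $F^\alpha$-integrable over every $[0,b]$ and the limit exists; it converges absolutely if it exists and the integral of $|h|$ exists as well. **Transforms.** For $f:[0,\infty)\to\mathbb R$ let $$\mathfrak L[f](v)=\int_0^\infty e^{-S(v)S(t)}f(S(t))\,d_F^\alpha t,\qquad \mathscr S[f](v)=\frac1{S(v)}\int_0^\infty e^{-S(t)/S(v)}f(S(t))\,d_F^\alpha t\quad(S(v)\neq0),$$ where the integrals exist, and for $f,g:[0,\infty)\to\mathbb R$ and $t\ge0$ let $$(f*g)(S(t))=\int_0^t f(S(t)-S(z))\,g(S(z))\,d_F^\alpha z.$$ **Proposition.** Let $f,g:[0,\infty)\to\mathbb R$ and $v\in\mathbb R$. 1. Suppose that $\mathfrak L[f](v)$ and $\mathfrak L[g](v)$ exist. Then the integral defining $(f*g)(S(t))$ exists for all $t\ge0$; if at least one of the integrals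 defining $\mathfrak L[f](v)$ and $\mathfrak L[g](v)$ converges absolutely, then $\mathfrak L[f*g](v)$ exists; and whenever $\mathfrak L[f*g](v)$ exists, $$\mathfrak L[f*g](v)=\mathfrak L[f](v)\,\mathfrak L[g](v).$$ 2. Suppose that $S(v)\ne0$ and that $\mathscr S[f](v)$ and $\mathscr S[g](v)$ exist. Then the integral defining $(f*g)(S(t))$ exists for all $t\ge0$; if at least one of the integrals defining $\mathscr S[f](v)$ and $\mathscr S[g](v)$ converges absolutely, then $\mathscr S[f*g](v)$ exists; and whenever $\mathscr S[f*g](v)$ exists, $$\mathscr S[f*g](v)=S(v)\,\mathscr S[f](v)\,\mathscr S[g](v).$$ -/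

import Mathlib

open Filter Topology
open scoped ENNReal

namespace FractalCalculus

noncomputable section

/-- `p 0, …, p n` is a subdivision `x = p 0 ≤ p 1 ≤ … ≤ p n = y` of `[x, y]`. Repeated points are
harmless: a degenerate piece contributes `0` to every sum below. -/
def IsSubdivision (x y : ℝ) (n : ℕ) (p : ℕ → ℝ) : Prop :=
  p 0 = x ∧ p n = y ∧ ∀ i < n, p i ≤ p (i + 1)

open Classical in
/-- The flag function `Θ(F, [x, y])`. -/
def flag (F : Set ℝ) (x y : ℝ) : ℝ := if (F ∩ Set.Icc x y).Nonempty then 1 else 0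

/-- The sum `σ^α[F, P]`. -/
def flagSum (F : Set ℝ) (α : ℝ) (n : ℕ) (p : ℕ → ℝ) : ℝ :=
  ∑ i ∈ Finset.range n, (p (i + 1) - p i) ^ α / Real.Gamma (α + 1) * flag F (p i) (p (i + 1))

/-- The coarse-grained mass `γ_δ^α(F, x, y)`: the infimum of `σ^α[F, P]` over the subdivisions `P`
of `[x, y]` with mesh at most `δ`. -/
def coarseMass (F : Set ℝ) (α δ x y : ℝ) : ℝ≥0∞ :=
  ⨅ (n : ℕ) (p : ℕ → ℝ) (_ : IsSubdivision x y n p) (_ : ∀ i < n, p (i + 1) - p i ≤ δ),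
    ENNReal.ofReal (flagSum F α n p)

/-- The mass function `γ^α(F, x, y) = lim_{δ → 0} γ_δ^α(F, x, y) ∈ [0, ∞]`. The coarse-grained mass
increases as `δ` decreases, so the limit is a supremum; see `tendsto_coarseMass`. -/
def mass (F : Set ℝ) (α x y : ℝ) : ℝ≥0∞ := ⨆ (δ : ℝ) (_ : 0 < δ), coarseMass F α δ x y

theorem tendsto_coarseMass (F : Set ℝ) (α x y : ℝ) :
    Tendsto (fun δ => coarseMass F α δ x y) (𝓝[>] 0) (𝓝 (mass F α x y)) := by
  have hanti : Antitone (fun δ => coarseMass F α δ x y) := by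
    intro δ₁ δ₂ h
    refine iInf_mono fun n => iInf_mono fun p => iInf_mono fun _ => ?_
    exact le_iInf fun hp => iInf_le _ (fun i hi => (hp i hi).trans h)
  have h := hanti.tendsto_nhdsGT 0
  rwa [sSup_image] at h

/-- The integral staircase function `S_F^α` with base point `l`. -/
def staircase (F : Set ℝ) (α l x : ℝ) : ℝ :=
  if l ≤ x then (mass F α l x).toReal else -(mass F α x l).toReal

/-- The upper `F^α`-sum of `h`: the supremum of `h` over `F ∩ [p i, p (i + 1)]` (`0` if that set is
empty) times the increment of the staircase function, summed over the pieces. -/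
def upperSum (F : Set ℝ) (α l : ℝ) (h : ℝ → ℝ) (n : ℕ) (p : ℕ → ℝ) : ℝ :=
  ∑ i ∈ Finset.range n, sSup (h '' (F ∩ Set.Icc (p i) (p (i + 1)))) *
    (staircase F α l (p (i + 1)) - staircase F α l (p i))

/-- The lower `F^α`-sum of `h`, with infima in place of suprema. -/
def lowerSum (F : Set ℝ) (α l : ℝ) (h : ℝ → ℝ) (n : ℕ) (p : ℕ → ℝ) : ℝ :=
  ∑ i ∈ Finset.range n, sInf (h '' (F ∩ Set.Icc (p i) (p (i + 1)))) *
    (staircase F α l (p (i + 1)) - staircase F α l (p i))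

/-- The upper `F^α`-integral of `h` over `[a, b]`. -/
def upperIntegral (F : Set ℝ) (α l : ℝ) (h : ℝ → ℝ) (a b : ℝ) : ℝ :=
  sInf {u | ∃ n p, IsSubdivision a b n p ∧ upperSum F α l h n p = u}

/-- The lower `F^α`-integral of `h` over `[a, b]`. -/
def lowerIntegral (F : Set ℝ) (α l : ℝ) (h : ℝ → ℝ) (a b : ℝ) : ℝ :=
  sSup {u | ∃ n p, IsSubdivision a b n p ∧ lowerSum F α l h n p = u}

/-- `h` is `F^α`-integrable over `[a, b]`: it is bounded on `F ∩ [a, b]`, and its lower and upper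
`F^α`-integrals coincide. -/
def Integrable (F : Set ℝ) (α l : ℝ) (h : ℝ → ℝ) (a b : ℝ) : Prop :=
  (∃ C, ∀ x ∈ F ∩ Set.Icc a b, |h x| ≤ C) ∧ lowerIntegral F α l h a b = upperIntegral F α l h a b

/-- The `F^α`-integral `∫_a^b h(t) d_F^α t` of an `F^α`-integrable function: the common value of the
lower and the upper integral. -/
def integral (F : Set ℝ) (α l : ℝ) (h : ℝ → ℝ) (a b : ℝ) : ℝ := upperIntegral F α l h a b

/-- The improper integral `∫_0^∞ h(t) d_F^α t` exists: `h` is `F^α`-integrable over every `[0, b]`,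
and `∫_0^b h(t) d_F^α t` converges as `b → ∞`. -/
def ImproperIntegrable (F : Set ℝ) (α l : ℝ) (h : ℝ → ℝ) : Prop :=
  (∀ b, 0 ≤ b → Integrable F α l h 0 b) ∧ ∃ I, Tendsto (fun b => integral F α l h 0 b) atTop (𝓝 I)

/-- The improper integral `∫_0^∞ h(t) d_F^α t`. -/
def improperIntegral (F : Set ℝ) (α l : ℝ) (h : ℝ → ℝ) : ℝ :=
  limUnder atTop (fun b => integral F α l h 0 b)

/-- The integrand `e^{-S_F^α(t) / S_F^α(v)} h(t)` of the fractal Sumudu transform. -/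
def sumuduIntegrand (F : Set ℝ) (α l : ℝ) (h : ℝ → ℝ) (v t : ℝ) : ℝ :=
  Real.exp (-(staircase F α l t / staircase F α l v)) * h t

/-- The integral defining the fractal Sumudu transform of `h` at `v` exists. -/
def SumuduExists (F : Set ℝ) (α l : ℝ) (h : ℝ → ℝ) (v : ℝ) : Prop :=
  ImproperIntegrable F α l (sumuduIntegrand F α l h v)

/-- The integral defining the fractal Sumudu transform of `h` at `v` converges absolutely. -/
def SumuduExistsAbs (F : Set ℝ) (α l : ℝ) (h : ℝ → ℝ) (v : ℝ) : Prop :=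
  SumuduExists F α l h v ∧ ImproperIntegrable F α l (fun t => |sumuduIntegrand F α l h v t|)

/-- The fractal Sumudu transform of a function `h` of `t`, at `v`. -/
def sumudu (F : Set ℝ) (α l : ℝ) (h : ℝ → ℝ) (v : ℝ) : ℝ :=
  1 / staircase F α l v * improperIntegral F α l (sumuduIntegrand F α l h v)

/-- The integrand `e^{-S_F^α(v) S_F^α(t)} h(t)` of the fractal Laplace transform. -/
def laplaceIntegrand (F : Set ℝ) (α l : ℝ) (h : ℝ → ℝ) (v t : ℝ) : ℝ :=
  Real.exp (-(staircase F α l v * staircase F α l t)) * h t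

/-- The integral defining the fractal Laplace transform of `h` at `v` exists. -/
def LaplaceExists (F : Set ℝ) (α l : ℝ) (h : ℝ → ℝ) (v : ℝ) : Prop :=
  ImproperIntegrable F α l (laplaceIntegrand F α l h v)

/-- The integral defining the fractal Laplace transform of `h` at `v` converges absolutely. -/
def LaplaceExistsAbs (F : Set ℝ) (α l : ℝ) (h : ℝ → ℝ) (v : ℝ) : Prop :=
  LaplaceExists F α l h v ∧ ImproperIntegrable F α l (fun t => |laplaceIntegrand F α l h v t|)

/-- The fractal Laplace transform of a function `h` of `t`, at `v`. -/
def laplace (F : Set ℝ) (α l : ℝ) (h : ℝ → ℝ) (v : ℝ) : ℝ :=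
  improperIntegral F α l (laplaceIntegrand F α l h v)

/-- The function `t ↦ f(S_F^α(t))`. -/
def onFractal (F : Set ℝ) (α l : ℝ) (f : ℝ → ℝ) (t : ℝ) : ℝ := f (staircase F α l t)

/-- The integrand `z ↦ f(S_F^α(t) - S_F^α(z)) g(S_F^α(z))` of the fractal convolution. -/
def convIntegrand (F : Set ℝ) (α l : ℝ) (f g : ℝ → ℝ) (t z : ℝ) : ℝ :=
  f (staircase F α l t - staircase F α l z) * g (staircase F α l z)

/-- The fractal convolution, as the function `t ↦ (f ∗ g)(S_F^α(t))`. -/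
def conv (F : Set ℝ) (α l : ℝ) (f g : ℝ → ℝ) (t : ℝ) : ℝ :=
  integral F α l (convIntegrand F α l f g t) 0 t

end

end FractalCalculus

/-! Everything is transported along the staircase function S to ordinary Riemann integrals on [0,
∞). S is monotone and continuous, and it maps F ∩ [u, w] onto [S(u), S(w)] as soon as S(u) < S(w)
(`staircase_image`). Hence the upper and lower sums of φ ∘ S over a subdivision are the Darboux sums
of φ over its image; pieces on which S is constant contribute 0 to both. So φ ∘ S is F^α-integrable
over [0, b] iff φ is Riemann integrable over [0, S(b)], with the same integral
(`integrable_iff_isRiemann`, `integral_eq_intervalIntegral`). As S is continuous and tends to ∞,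
improper integrals correspond as well (`improperIntegrable_iff`).

Both transforms have a kernel e^{-pS(t)}, with p = S(v) or p = 1/S(v). Since e^{-px} = e^{-p(x-r)}
e^{-pr}, the kernel can be absorbed into the two functions. What remains concerns locally Riemann
integrable φ, ψ with convergent integrals A, B over [0, ∞). Write Φ, Ψ for their primitives.

The convolution φ * ψ is continuous, and Fubini shows that its primitive is Φ * ψ
(`primitive_realConv`). If ∫|φ| converges, the primitive Ψ * φ converges by domination
(`tendsto_primitive_realConv`, after Mertens). If the primitive of φ * ψ tends to some C, a second
integration gives Φ * Ψ; divided by x, it tends to C as a Cesàro mean and to AB by rescaling, so C =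
AB (`eq_mul_of_tendsto_primitive_realConv`, after Abel). -/

namespace FractalCalculus

/-! ### Additivity of the mass function -/

theorem gammaConst_pos {α : ℝ} (hα : 0 < α) : 0 < Real.Gamma (α + 1) :=
  Real.Gamma_pos_of_pos (by linarith)

theorem flag_nonneg (F : Set ℝ) (x y : ℝ) : 0 ≤ flag F x y := by
  unfold flag; split_ifs <;> norm_num

theorem flag_le_one (F : Set ℝ) (x y : ℝ) : flag F x y ≤ 1 := by
  unfold flag; split_ifs <;> norm_num

theorem flagTerm_nonneg (F : Set ℝ) {α : ℝ} (hα : 0 < α) {x y : ℝ} (h : x ≤ y) :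
    0 ≤ (y - x) ^ α / Real.Gamma (α + 1) * flag F x y :=
  mul_nonneg (div_nonneg (Real.rpow_nonneg (sub_nonneg.2 h) _) (gammaConst_pos hα).le)
    (flag_nonneg F x y)

theorem flagTerm_self (F : Set ℝ) {α : ℝ} (hα : 0 < α) (x : ℝ) :
    (x - x) ^ α / Real.Gamma (α + 1) * flag F x x = 0 := by
  rw [sub_self, Real.zero_rpow hα.ne', zero_div, zero_mul]

theorem flagTerm_le (F : Set ℝ) {α : ℝ} (hα : 0 < α) {x y δ : ℝ} (h : x ≤ y) (hδ : y - x ≤ δ) :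
    (y - x) ^ α / Real.Gamma (α + 1) * flag F x y ≤ δ ^ α / Real.Gamma (α + 1) := by
  have h0 := sub_nonneg.2 h
  have h1 : (y - x) ^ α / Real.Gamma (α + 1) ≤ δ ^ α / Real.Gamma (α + 1) :=
    div_le_div_of_nonneg_right (Real.rpow_le_rpow h0 hδ hα.le) (gammaConst_pos hα).le
  have h2 : 0 ≤ (y - x) ^ α / Real.Gamma (α + 1) :=
    div_nonneg (Real.rpow_nonneg h0 _) (gammaConst_pos hα).le
  exact (mul_le_of_le_one_right h2 (flag_le_one F x y)).trans h1

theorem flagSum_nonneg (F : Set ℝ) {α : ℝ} (hα : 0 < α) {n : ℕ} {p : ℕ → ℝ}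
    (hp : ∀ i < n, p i ≤ p (i + 1)) : 0 ≤ flagSum F α n p :=
  Finset.sum_nonneg fun i hi => flagTerm_nonneg F hα (hp i (Finset.mem_range.1 hi))

theorem coarseMass_le_mass (F : Set ℝ) (α x y : ℝ) {δ : ℝ} (hδ : 0 < δ) :
    coarseMass F α δ x y ≤ mass F α x y :=
  le_iSup₂ (f := fun δ (_ : 0 < δ) => coarseMass F α δ x y) δ hδ

theorem coarseMass_le_ofReal {F : Set ℝ} {α δ x y : ℝ} {n : ℕ} {p : ℕ → ℝ}
    (hp : IsSubdivision x y n p) (hmesh : ∀ i < n, p (i + 1) - p i ≤ δ) :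
    coarseMass F α δ x y ≤ ENNReal.ofReal (flagSum F α n p) :=
  iInf_le_of_le n <| iInf_le_of_le p <| iInf_le_of_le hp <| iInf_le_of_le hmesh le_rfl

theorem coarseMass_le_of_short (F : Set ℝ) {α δ x y : ℝ} (hα : 0 < α) (h : x ≤ y)
    (hδ : y - x ≤ δ) :
    coarseMass F α δ x y ≤ ENNReal.ofReal ((y - x) ^ α / Real.Gamma (α + 1)) := by
  have hp : IsSubdivision x y 1 (fun i => if i = 0 then x else y) :=
    ⟨by simp, by simp, by intro i hi; obtain rfl : i = 0 := by omega
                          simpa using h⟩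
  refine (coarseMass_le_ofReal hp ?_).trans (ENNReal.ofReal_le_ofReal ?_)
  · intro i hi
    obtain rfl : i = 0 := by omega
    simpa using hδ
  · simpa [flagSum] using flagTerm_le F hα h le_rfl

/-- Concatenating subdivisions of mesh at most δ gives another one, and the flag sums add. -/
theorem coarseMass_add_le (F : Set ℝ) {α : ℝ} (hα : 0 < α) (δ x y z : ℝ) :
    coarseMass F α δ x z ≤ coarseMass F α δ x y + coarseMass F α δ y z := by
  unfold coarseMass
  simp only [ENNReal.iInf_add, ENNReal.add_iInf]
  refine le_iInf fun m => le_iInf fun q => le_iInf fun hq => le_iInf fun hqm =>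
    le_iInf fun n => le_iInf fun p => le_iInf fun hp => le_iInf fun hpm => ?_
  set r : ℕ → ℝ := fun i => if i ≤ n then p i else q (i - n) with hr
  have r1 : ∀ i ≤ n, r i = p i := fun i hi => by simp [hr, hi]
  have r2 : ∀ i, r (n + i) = q i := fun i => by
    rcases Nat.eq_zero_or_pos i with rfl | hi
    · simp [hr, hp.2.1, hq.1]
    · simp [hr, hi.ne']
  have hsum : flagSum F α (n + m) r = flagSum F α n p + flagSum F α m q := by
    unfold flagSum
    rw [Finset.sum_range_add]
    congr 1
    · refine Finset.sum_congr rfl fun i hi => ?_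
      have hi := Finset.mem_range.1 hi
      rw [r1 i hi.le, r1 (i + 1) hi]
    · refine Finset.sum_congr rfl fun i _ => ?_
      rw [add_assoc, r2, r2]
  have key : ∀ P : ℝ → ℝ → Prop, (∀ i < n, P (p i) (p (i + 1))) →
      (∀ i < m, P (q i) (q (i + 1))) → ∀ i < n + m, P (r i) (r (i + 1)) := by
    intro P h1 h2 i hi
    rcases lt_or_ge i n with h | h
    · rw [r1 i h.le, r1 (i + 1) h]; exact h1 i h
    · obtain ⟨j, rfl⟩ := Nat.exists_eq_add_of_le h
      rw [add_assoc, r2, r2]; exact h2 j (by omega)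
  have hsub : IsSubdivision x z (n + m) r :=
    ⟨by rw [r1 0 (Nat.zero_le _), hp.1], by rw [r2, hq.2.1], key (· ≤ ·) hp.2.2 hq.2.2⟩
  rw [← ENNReal.ofReal_add (flagSum_nonneg F hα hp.2.2) (flagSum_nonneg F hα hq.2.2), ← hsum]
  exact coarseMass_le_ofReal hsub (key (fun a b => b - a ≤ δ) hpm hqm)

/-- Clipping a subdivision at `y` cuts at most one piece in two, and each half costs at most `δ ^ α
/ Γ(α + 1)`. Every other piece survives on one side and degenerates on the other, where it
contributes 0 because `0 ^ α = 0`. -/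
theorem flagSum_min_add_flagSum_max_le (F : Set ℝ) {α : ℝ} (hα : 0 < α) {δ y : ℝ} (hδ : 0 < δ)
    {n : ℕ} {p : ℕ → ℝ} (hp : ∀ i < n, p i ≤ p (i + 1)) (hm : ∀ i < n, p (i + 1) - p i ≤ δ) :
    flagSum F α n (fun i => min (p i) y) + flagSum F α n (fun i => max (p i) y) ≤
      flagSum F α n p + 2 * (δ ^ α / Real.Gamma (α + 1)) := by
  classical
  set K := δ ^ α / Real.Gamma (α + 1)
  have hK0 : 0 ≤ K := div_nonneg (Real.rpow_nonneg hδ.le _) (gammaConst_pos hα).le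
  -- `e i - e (i + 1)` is 1 exactly on the piece with `p i < y ≤ p (i + 1)` and 0 on the others, so
  -- telescoping counts the cut pieces.
  set e : ℕ → ℝ := fun i => if p i < y then 1 else 0 with he
  have tele : ∑ i ∈ Finset.range n, (e i - e (i + 1)) ≤ 1 := by
    rw [Finset.sum_range_sub']
    simp only [he]; split_ifs <;> norm_num
  have hterm : ∀ i ∈ Finset.range n,
      ((min (p (i + 1)) y - min (p i) y) ^ α / Real.Gamma (α + 1) *
          flag F (min (p i) y) (min (p (i + 1)) y) +
        (max (p (i + 1)) y - max (p i) y) ^ α / Real.Gamma (α + 1) *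
          flag F (max (p i) y) (max (p (i + 1)) y)) ≤
      (p (i + 1) - p i) ^ α / Real.Gamma (α + 1) * flag F (p i) (p (i + 1)) +
        2 * K * (e i - e (i + 1)) := by
    intro i hi
    have hi := Finset.mem_range.1 hi
    have h1 := hp i hi
    have h2 := hm i hi
    rcases le_or_gt y (p i) with h | h
    · have h' := h.trans h1
      simp only [he, min_eq_right h, min_eq_right h', max_eq_left h, max_eq_left h',
        flagTerm_self F hα, not_lt.2 h, not_lt.2 h', if_false]
      simp
    · rcases lt_or_ge (p (i + 1)) y with h' | h'
      · simp only [he, min_eq_left h.le, min_eq_left h'.le, max_eq_right h.le, max_eq_right h'.le,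
          flagTerm_self F hα, h, h', if_true]
        simp
      · simp only [he, min_eq_left h.le, min_eq_right h', max_eq_right h.le, max_eq_left h',
          h, not_lt.2 h', if_true, if_false]
        have a1 := flagTerm_le F hα h.le (show y - p i ≤ δ by linarith)
        have a2 := flagTerm_le F hα h' (show p (i + 1) - y ≤ δ by linarith)
        have a3 := flagTerm_nonneg F hα h1
        linarith
  unfold flagSum
  rw [← Finset.sum_add_distrib]
  refine (Finset.sum_le_sum hterm).trans ?_
  rw [Finset.sum_add_distrib, ← Finset.mul_sum]
  nlinarith

theorem coarseMass_add_coarseMass_le (F : Set ℝ) {α : ℝ} (hα : 0 < α) {δ x y z : ℝ} (hδ : 0 < δ)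
    (hxy : x ≤ y) (hyz : y ≤ z) :
    coarseMass F α δ x y + coarseMass F α δ y z ≤
      coarseMass F α δ x z + ENNReal.ofReal (2 * (δ ^ α / Real.Gamma (α + 1))) := by
  conv_rhs => unfold coarseMass
  simp only [ENNReal.iInf_add]
  refine le_iInf fun n => le_iInf fun p => le_iInf fun hp => le_iInf fun hpm => ?_
  have hsub1 : IsSubdivision x y n (fun i => min (p i) y) :=
    ⟨by simp [hp.1, hxy], by simp [hp.2.1, hyz],
      fun i hi => min_le_min_right _ (hp.2.2 i hi)⟩
  have hsub2 : IsSubdivision y z n (fun i => max (p i) y) :=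
    ⟨by simp [hp.1, hxy], by simp [hp.2.1, hyz],
      fun i hi => max_le_max_right _ (hp.2.2 i hi)⟩
  have hm1 : ∀ i < n, min (p (i + 1)) y - min (p i) y ≤ δ := fun i hi => by
    have h1 := hp.2.2 i hi
    have h2 := hpm i hi
    rcases le_total (p i) y with h | h <;> rcases le_total (p (i + 1)) y with h' | h' <;>
      simp [h, h'] <;> linarith
  have hm2 : ∀ i < n, max (p (i + 1)) y - max (p i) y ≤ δ := fun i hi => by
    have h1 := hp.2.2 i hi
    have h2 := hpm i hi
    rcases le_total (p i) y with h | h <;> rcases le_total (p (i + 1)) y with h' | h' <;>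
      simp [h, h'] <;> linarith
  refine (add_le_add (coarseMass_le_ofReal hsub1 hm1) (coarseMass_le_ofReal hsub2 hm2)).trans ?_
  have hK0 : 0 ≤ δ ^ α / Real.Gamma (α + 1) :=
    div_nonneg (Real.rpow_nonneg hδ.le _) (gammaConst_pos hα).le
  rw [← ENNReal.ofReal_add (flagSum_nonneg F hα hsub1.2.2) (flagSum_nonneg F hα hsub2.2.2),
    ← ENNReal.ofReal_add (flagSum_nonneg F hα hp.2.2) (by positivity)]
  exact ENNReal.ofReal_le_ofReal (flagSum_min_add_flagSum_max_le F hα hδ hp.2.2 hpm)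

/-- At scale `δ` the coarse masses are additive up to an error of order `δ ^ α`, which vanishes in
the limit. -/
theorem mass_add (F : Set ℝ) {α : ℝ} (hα : 0 < α) {x y z : ℝ} (hxy : x ≤ y) (hyz : y ≤ z) :
    mass F α x y + mass F α y z = mass F α x z := by
  have t1 := (tendsto_coarseMass F α x y).add (tendsto_coarseMass F α y z)
  have t2 := tendsto_coarseMass F α x z
  apply le_antisymm
  · have t3 : Tendsto (fun δ : ℝ => ENNReal.ofReal (2 * (δ ^ α / Real.Gamma (α + 1)))) (𝓝[>] 0)
        (𝓝 0) := by
      have : Tendsto (fun δ : ℝ => 2 * (δ ^ α / Real.Gamma (α + 1))) (𝓝[>] 0) (𝓝 0) := by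
        have h : ContinuousAt (fun δ : ℝ => 2 * (δ ^ α / Real.Gamma (α + 1))) 0 :=
          continuousAt_const.mul
            ((Real.continuousAt_rpow_const 0 α (Or.inr hα.le)).div_const _)
        have := h.tendsto
        simp only [Real.zero_rpow hα.ne', zero_div, mul_zero] at this
        exact this.mono_left nhdsWithin_le_nhds
      simpa using ENNReal.tendsto_ofReal this
    have := t2.add t3
    rw [add_zero] at this
    refine le_of_tendsto_of_tendsto t1 this ?_
    filter_upwards [self_mem_nhdsWithin] with δ hδ
    exact coarseMass_add_coarseMass_le F hα hδ hxy hyz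
  · exact le_of_tendsto_of_tendsto' t2 t1 fun δ => coarseMass_add_le F hα δ x y z

/-! ### Subdivisions, and monotonicity, continuity and image of the staircase function -/

theorem isSubdivision_uniform {x y : ℝ} (h : x ≤ y) (N : ℕ) :
    IsSubdivision x y (N + 1) (fun i => x + i * ((y - x) / (N + 1))) := by
  refine ⟨by simp, ?_, fun i _ => ?_⟩
  · have : (N : ℝ) + 1 ≠ 0 := by positivity
    push_cast
    field_simp
    ring
  · have : 0 ≤ (y - x) / ((N : ℝ) + 1) := div_nonneg (sub_nonneg.2 h) (by positivity)
    push_cast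
    nlinarith

theorem IsSubdivision.monotoneOn {x y : ℝ} {n : ℕ} {p : ℕ → ℝ} (hp : IsSubdivision x y n p)
    {i j : ℕ} (hij : i ≤ j) (hj : j ≤ n) : p i ≤ p j := by
  induction j, hij using Nat.le_induction with
  | base => exact le_rfl
  | succ j hij ih => exact (ih (by omega)).trans (hp.2.2 j (by omega))

theorem IsSubdivision.mem_Icc {x y : ℝ} {n : ℕ} {p : ℕ → ℝ} (hp : IsSubdivision x y n p)
    {i : ℕ} (hi : i ≤ n) : p i ∈ Set.Icc x y :=
  ⟨hp.1 ▸ hp.monotoneOn (Nat.zero_le i) hi, hp.2.1 ▸ hp.monotoneOn hi le_rfl⟩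

theorem mass_eq_zero_of_disjoint {F : Set ℝ} (α : ℝ) {x y : ℝ} (h : x ≤ y)
    (hF : F ∩ Set.Icc x y = ∅) : mass F α x y = 0 := by
  refine le_antisymm (iSup₂_le fun δ hδ => ?_) bot_le
  obtain ⟨N, hN⟩ := exists_nat_gt ((y - x) / δ)
  have hp := isSubdivision_uniform h N
  refine (coarseMass_le_ofReal hp ?_).trans ?_
  · intro i _
    have : (y - x) / ((N : ℝ) + 1) ≤ δ := by
      rw [div_lt_iff₀ hδ] at hN
      rw [div_le_iff₀ (by positivity)]
      nlinarith
    push_cast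
    linarith
  · rw [flagSum, Finset.sum_eq_zero, ENNReal.ofReal_zero]
    intro i hi
    have hi := Finset.mem_range.1 hi
    have : ¬ (F ∩ Set.Icc (x + i * ((y - x) / (N + 1)))
        (x + (i + 1 : ℕ) * ((y - x) / (N + 1)))).Nonempty := by
      rintro ⟨z, hz, hz'⟩
      have : z ∈ F ∩ Set.Icc x y :=
        ⟨hz, (hp.mem_Icc hi.le).1.trans hz'.1, hz'.2.trans (hp.mem_Icc hi).2⟩
      rw [hF] at this
      exact this
    simp only [flag, this, if_false, mul_zero]

theorem staircase_sub {F : Set ℝ} {α : ℝ} (hα : 0 < α) (l : ℝ)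
    (hfin : ∀ x y : ℝ, x ≤ y → mass F α x y ≠ ⊤) {x y : ℝ} (h : x ≤ y) :
    staircase F α l y - staircase F α l x = (mass F α x y).toReal := by
  have add : ∀ {a b c : ℝ}, a ≤ b → b ≤ c →
      (mass F α a c).toReal = (mass F α a b).toReal + (mass F α b c).toReal := by
    intro a b c hab hbc
    rw [← mass_add F hα hab hbc, ENNReal.toReal_add (hfin _ _ hab) (hfin _ _ hbc)]
  unfold staircase
  split_ifs with h1 h2 h2
  · rw [add h2 h]; ring
  · rw [add (not_le.1 h2).le h1]; ring
  · exact absurd (h2.trans h) h1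
  · rw [add h (not_le.1 h1).le]; ring

theorem monotone_staircase {F : Set ℝ} {α : ℝ} (hα : 0 < α) (l : ℝ)
    (hfin : ∀ x y : ℝ, x ≤ y → mass F α x y ≠ ⊤) : Monotone (staircase F α l) := by
  intro x y h
  have := staircase_sub hα l hfin h
  have h0 : 0 ≤ (mass F α x y).toReal := ENNReal.toReal_nonneg
  linarith

/-- The source of continuity: covering `[u, w]` by a single piece bounds its mass by the defect
`mass - coarseMass` of the large interval plus `(w - u) ^ α / Γ(α + 1)`. The defect is small for
small `δ`, uniformly in `u` and `w`. -/
theorem mass_le_of_mem_Icc (F : Set ℝ) {α : ℝ} (hα : 0 < α) {a b u w δ : ℝ} (hau : a ≤ u) (huw : u ≤ w)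
    (hwb : w ≤ b) (hδ : 0 < δ) (hshort : w - u ≤ δ) :
    mass F α u w + coarseMass F α δ a b ≤
      mass F α a b + ENNReal.ofReal ((w - u) ^ α / Real.Gamma (α + 1)) := by
  have h1 : coarseMass F α δ a b ≤
      mass F α a u + (ENNReal.ofReal ((w - u) ^ α / Real.Gamma (α + 1)) + mass F α w b) := by
    refine (coarseMass_add_le F hα δ a u b).trans (add_le_add (coarseMass_le_mass F α a u hδ) ?_)
    exact (coarseMass_add_le F hα δ u w b).trans (add_le_add
      (coarseMass_le_of_short F hα huw hshort) (coarseMass_le_mass F α w b hδ))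
  rw [← mass_add F hα hau (huw.trans hwb), ← mass_add F hα huw hwb]
  refine (add_le_add le_rfl h1).trans (le_of_eq ?_)
  ring

theorem continuous_staircase {F : Set ℝ} {α : ℝ} (hα : 0 < α) (l : ℝ)
    (hfin : ∀ x y : ℝ, x ≤ y → mass F α x y ≠ ⊤) : Continuous (staircase F α l) := by
  rw [continuous_iff_continuousAt]
  intro x
  rw [Metric.continuousAt_iff]
  intro ε hε
  set a := x - 1
  set b := x + 1
  have hab : mass F α a b ≠ ⊤ := hfin _ _ (by simp only [a, b]; linarith)
  obtain ⟨δ, hδ, hδε⟩ : ∃ δ : ℝ, 0 < δ ∧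
      (mass F α a b).toReal - ε / 2 < (coarseMass F α δ a b).toReal := by
    have t := (ENNReal.tendsto_toReal hab).comp (tendsto_coarseMass F α a b)
    have := (t.eventually (lt_mem_nhds (show (mass F α a b).toReal - ε / 2 <
      (mass F α a b).toReal by linarith))).and self_mem_nhdsWithin
    obtain ⟨δ, h1, h2⟩ := this.exists
    exact ⟨δ, h2, h1⟩
  obtain ⟨η, hη, hηε⟩ : ∃ η : ℝ, 0 < η ∧ ∀ r, 0 ≤ r → r < η →
      r ^ α / Real.Gamma (α + 1) < ε / 2 := by
    have h : ContinuousAt (fun r : ℝ => r ^ α / Real.Gamma (α + 1)) 0 :=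
      (Real.continuousAt_rpow_const 0 α (Or.inr hα.le)).div_const _
    obtain ⟨η, hη, h⟩ := Metric.continuousAt_iff.1 h (ε / 2) (by linarith)
    refine ⟨η, hη, fun r hr hrη => ?_⟩
    have := h (show dist r 0 < η by simpa [abs_of_nonneg hr] using hrη)
    rw [Real.zero_rpow hα.ne', zero_div, Real.dist_eq, sub_zero] at this
    exact (le_abs_self _).trans_lt this
  have key : ∀ u w, a ≤ u → u ≤ w → w ≤ b → w - u < min δ η →
      staircase F α l w - staircase F α l u < ε := by
    intro u w hau huw hwb hd
    rw [staircase_sub hα l hfin huw]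
    have h := mass_le_of_mem_Icc F hα hau huw hwb hδ (hd.le.trans (min_le_left _ _))
    have h2 := hηε (w - u) (sub_nonneg.2 huw) (hd.trans_le (min_le_right _ _))
    have h0 : 0 ≤ (w - u) ^ α / Real.Gamma (α + 1) :=
      div_nonneg (Real.rpow_nonneg (sub_nonneg.2 huw) _) (gammaConst_pos hα).le
    have hc : coarseMass F α δ a b ≠ ⊤ :=
      ne_top_of_le_ne_top hab (coarseMass_le_mass F α a b hδ)
    have h3 := ENNReal.toReal_mono (ENNReal.add_ne_top.2 ⟨hab, ENNReal.ofReal_ne_top⟩) h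
    rw [ENNReal.toReal_add (hfin _ _ huw) hc, ENNReal.toReal_add hab ENNReal.ofReal_ne_top,
      ENNReal.toReal_ofReal h0] at h3
    linarith
  refine ⟨min 1 (min δ η), by positivity, fun {y} hy => ?_⟩
  have hmono := monotone_staircase hα l hfin
  rw [Real.dist_eq] at hy ⊢
  have hy1 := hy.trans_le (min_le_left _ _)
  have hy2 := hy.trans_le (min_le_right _ _)
  rw [abs_lt] at hy1
  rcases le_total x y with h | h
  · rw [abs_of_nonneg (sub_nonneg.2 (hmono h))]
    rw [abs_of_nonneg (sub_nonneg.2 h)] at hy2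
    exact key x y (by simp only [a]; linarith) h (by simp only [b]; linarith) hy2
  · rw [abs_of_nonpos (sub_nonpos.2 (hmono h)), neg_sub]
    rw [abs_of_nonpos (sub_nonpos.2 h), neg_sub] at hy2
    exact key y x (by simp only [a]; linarith) h (by simp only [b]; linarith) hy2

theorem staircase_eq_of_disjoint {F : Set ℝ} {α : ℝ} (hα : 0 < α) (l : ℝ)
    (hfin : ∀ x y : ℝ, x ≤ y → mass F α x y ≠ ⊤) {x y : ℝ} (h : x ≤ y)
    (hF : F ∩ Set.Icc x y = ∅) : staircase F α l x = staircase F α l y := by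
  have := staircase_sub hα l hfin h
  rw [mass_eq_zero_of_disjoint α h hF, ENNReal.toReal_zero] at this
  linarith

theorem exists_disjoint_Icc {F : Set ℝ} (hF : IsClosed F) {x : ℝ} (hx : x ∉ F) {η : ℝ}
    (hη : 0 < η) : ∃ ε, 0 < ε ∧ ε < η ∧ F ∩ Set.Icc (x - ε) (x + ε) = ∅ := by
  obtain ⟨r, hr, h⟩ := Metric.isOpen_iff.1 hF.isOpen_compl x hx
  refine ⟨min r η / 2, by positivity, ?_, ?_⟩
  · have := min_le_right r η; linarith
  · ext z
    simp only [Set.mem_inter_iff, Set.mem_Icc, Set.mem_empty_iff_false, iff_false, not_and]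
    intro hz h1 h2
    refine h (?_ : z ∈ Metric.ball x r) hz
    have := min_le_left r η
    rw [Metric.mem_ball, Real.dist_eq, abs_lt]
    constructor <;> linarith

/-- The level set of `s` in `[u, w]` is compact and nonempty. If its greatest point lay outside the
closed set `F`, the staircase would be constant slightly beyond it, a contradiction. For `s = S w`
that point is `w`, which need not lie in `F`, so the least point is used instead; it exceeds `u`
because of `hS`. -/
theorem staircase_image {F : Set ℝ} (hF : IsClosed F) {α : ℝ} (hα : 0 < α) (l : ℝ)
    (hfin : ∀ x y : ℝ, x ≤ y → mass F α x y ≠ ⊤) {u w : ℝ}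
    (hS : staircase F α l u < staircase F α l w) :
    staircase F α l '' (F ∩ Set.Icc u w) =
      Set.Icc (staircase F α l u) (staircase F α l w) := by
  set S := staircase F α l
  have hmono : Monotone S := monotone_staircase hα l hfin
  have hcont : Continuous S := continuous_staircase hα l hfin
  have huw : u ≤ w := by
    by_contra h
    exact absurd (hmono (not_le.1 h).le) (not_le.2 hS)
  apply Set.Subset.antisymm
  · rintro _ ⟨z, ⟨_, h1, h2⟩, rfl⟩
    exact ⟨hmono h1, hmono h2⟩
  · rintro s ⟨h1, h2⟩
    have hcpt : IsCompact (Set.Icc u w ∩ S ⁻¹' {s}) :=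
      isCompact_Icc.inter_right ((isClosed_singleton).preimage hcont)
    have hne : (Set.Icc u w ∩ S ⁻¹' {s}).Nonempty := by
      obtain ⟨z, hz, hz'⟩ := intermediate_value_Icc huw hcont.continuousOn ⟨h1, h2⟩
      exact ⟨z, hz, hz'⟩
    rcases h2.lt_or_eq with h2 | rfl
    · obtain ⟨b, ⟨hb, hbs⟩, hmax⟩ := hcpt.exists_isGreatest hne
      have hbs : S b = s := hbs
      have hbw : b < w := by
        rcases hb.2.lt_or_eq with h | rfl
        · exact h
        · exact absurd hbs h2.ne'
      refine ⟨b, ⟨?_, hb⟩, hbs⟩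
      by_contra hbF
      obtain ⟨ε, hε, hεw, hd⟩ := exists_disjoint_Icc hF hbF (sub_pos.2 hbw)
      have hd' : F ∩ Set.Icc b (b + ε) = ∅ := by
        refine Set.subset_empty_iff.1 (hd ▸ Set.inter_subset_inter_right _ ?_)
        exact Set.Icc_subset_Icc (by linarith) le_rfl
      have he := staircase_eq_of_disjoint hα l hfin (show b ≤ b + ε by linarith) hd'
      have : b + ε ≤ b :=
        hmax ⟨⟨by linarith [hb.1], by linarith⟩, (he.symm.trans hbs : S (b + ε) = s)⟩
      linarith
    · obtain ⟨b, ⟨hb, hbs⟩, hmin⟩ := hcpt.exists_isLeast hne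
      have hbs : S b = S w := hbs
      have hub : u < b := by
        rcases hb.1.lt_or_eq with h | rfl
        · exact h
        · exact absurd hbs hS.ne
      refine ⟨b, ⟨?_, hb⟩, hbs⟩
      by_contra hbF
      obtain ⟨ε, hε, hεw, hd⟩ := exists_disjoint_Icc hF hbF (sub_pos.2 hub)
      have hd' : F ∩ Set.Icc (b - ε) b = ∅ := by
        refine Set.subset_empty_iff.1 (hd ▸ Set.inter_subset_inter_right _ ?_)
        exact Set.Icc_subset_Icc le_rfl (by linarith)
      have he := staircase_eq_of_disjoint hα l hfin (show b - ε ≤ b by linarith) hd'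
      have : b ≤ b - ε :=
        hmin ⟨⟨by linarith, by linarith [hb.2]⟩, (he.trans hbs : S (b - ε) = S w)⟩
      linarith

/-! ### Darboux sums and Lebesgue's criterion -/

open MeasureTheory Set

/-- `φ` is bounded on `[0, b]` and almost everywhere continuous on `(0, b)`: Lebesgue's criterion
for Riemann integrability. -/
def IsRiemann (φ : ℝ → ℝ) (b : ℝ) : Prop :=
  (∃ C, ∀ s ∈ Icc 0 b, |φ s| ≤ C) ∧ ∀ᵐ s, s ∈ Ioo 0 b → ContinuousAt φ s

/-- The step function with value `c i` on `(q i, q (i + 1)]` for `i < n`. -/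
noncomputable def stepFun (n : ℕ) (q c : ℕ → ℝ) (s : ℝ) : ℝ :=
  ∑ i ∈ Finset.range n, (Ioc (q i) (q (i + 1))).indicator (fun _ => c i) s

theorem measurable_stepFun (n : ℕ) (q c : ℕ → ℝ) : Measurable (stepFun n q c) :=
  Finset.measurable_fun_sum _ fun _ _ => measurable_const.indicator measurableSet_Ioc

theorem stepFun_eq {a b : ℝ} {n : ℕ} {q : ℕ → ℝ} (hq : IsSubdivision a b n q) (c : ℕ → ℝ) {i : ℕ}
    (hi : i < n) {s : ℝ} (hs : s ∈ Ioc (q i) (q (i + 1))) : stepFun n q c s = c i := by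
  unfold stepFun
  rw [Finset.sum_eq_single i, indicator_of_mem hs]
  · intro j hj hji
    have hj := Finset.mem_range.1 hj
    refine indicator_of_notMem (fun h => ?_) _
    rcases lt_or_gt_of_ne hji with h' | h'
    · have := hq.monotoneOn (show j + 1 ≤ i from h') hi.le
      linarith [h.2, hs.1]
    · have := hq.monotoneOn (show i + 1 ≤ j from h') hj.le
      linarith [h.1, hs.2]
  · intro h
    exact absurd (Finset.mem_range.2 hi) h

theorem exists_mem_Ioc_of_isSubdivision {a b : ℝ} {n : ℕ} {q : ℕ → ℝ} (hq : IsSubdivision a b n q)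
    {s : ℝ} (hs : s ∈ Ioc a b) : ∃ i < n, s ∈ Ioc (q i) (q (i + 1)) := by
  have key : ∀ m, s ≤ q m → ∃ i < m, s ∈ Ioc (q i) (q (i + 1)) := by
    intro m
    induction m with
    | zero => intro h; rw [hq.1] at h; exact absurd h (not_le.2 hs.1)
    | succ m ih =>
      intro h
      rcases le_or_gt s (q m) with h' | h'
      · obtain ⟨i, hi, his⟩ := ih h'
        exact ⟨i, by omega, his⟩
      · exact ⟨m, by omega, h', h⟩
  exact key n (hq.2.1 ▸ hs.2)

theorem integrableOn_stepFun (n : ℕ) (q c : ℕ → ℝ) (a b : ℝ) :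
    IntegrableOn (stepFun n q c) (Ioc a b) := by
  unfold stepFun
  refine integrable_finsetSum _ fun i _ => ?_
  have : IntegrableOn (fun _ : ℝ => c i) (Ioc a b) := by simp
  exact MeasureTheory.Integrable.indicator this measurableSet_Ioc

theorem setIntegral_stepFun {a b : ℝ} {n : ℕ} {q : ℕ → ℝ} (hq : IsSubdivision a b n q)
    (c : ℕ → ℝ) :
    ∫ s in Ioc a b, stepFun n q c s = ∑ i ∈ Finset.range n, c i * (q (i + 1) - q i) := by
  unfold stepFun
  rw [integral_finsetSum]
  · refine Finset.sum_congr rfl fun i hi => ?_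
    have hi := Finset.mem_range.1 hi
    rw [setIntegral_indicator measurableSet_Ioc, inter_eq_right.2
      (Ioc_subset_Ioc (hq.mem_Icc hi.le).1 (hq.mem_Icc hi).2), setIntegral_const, smul_eq_mul,
      Real.volume_real_Ioc_of_le (hq.2.2 i hi), mul_comm]
  · intro i _
    have : IntegrableOn (fun _ : ℝ => c i) (Ioc a b) := by simp
    exact MeasureTheory.Integrable.indicator this measurableSet_Ioc

/-- The upper Darboux sum of `φ`. -/
noncomputable def upperDarboux (φ : ℝ → ℝ) (n : ℕ) (q : ℕ → ℝ) : ℝ :=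
  ∑ i ∈ Finset.range n, sSup (φ '' Icc (q i) (q (i + 1))) * (q (i + 1) - q i)

/-- The lower Darboux sum of `φ`. -/
noncomputable def lowerDarboux (φ : ℝ → ℝ) (n : ℕ) (q : ℕ → ℝ) : ℝ :=
  ∑ i ∈ Finset.range n, sInf (φ '' Icc (q i) (q (i + 1))) * (q (i + 1) - q i)

theorem bddAbove_image_piece {φ : ℝ → ℝ} {C b : ℝ} (hC : ∀ s ∈ Icc 0 b, |φ s| ≤ C) {n : ℕ}
    {q : ℕ → ℝ} (hq : IsSubdivision 0 b n q) {i : ℕ} (hi : i < n) :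
    BddAbove (φ '' Icc (q i) (q (i + 1))) := by
  refine ⟨C, ?_⟩
  rintro _ ⟨s, hs, rfl⟩
  exact (abs_le.1 (hC s ⟨(hq.mem_Icc hi.le).1.trans hs.1, hs.2.trans (hq.mem_Icc hi).2⟩)).2

theorem bddBelow_image_piece {φ : ℝ → ℝ} {C b : ℝ} (hC : ∀ s ∈ Icc 0 b, |φ s| ≤ C) {n : ℕ}
    {q : ℕ → ℝ} (hq : IsSubdivision 0 b n q) {i : ℕ} (hi : i < n) :
    BddBelow (φ '' Icc (q i) (q (i + 1))) := by
  refine ⟨-C, ?_⟩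
  rintro _ ⟨s, hs, rfl⟩
  exact (abs_le.1 (hC s ⟨(hq.mem_Icc hi.le).1.trans hs.1, hs.2.trans (hq.mem_Icc hi).2⟩)).1

/-- Step functions `v k ≤ φ ≤ u k` with integral gap at most `1 / (k + 1)` satisfy `⨅ k, (u k - v k)
= 0` almost everywhere. Away from the countably many nodes they are locally constant, so this gap
bounds the oscillation of `φ`. Upper and lower sums may use different subdivisions, so no common
refinement is required. -/
theorem ae_continuousAt_of_darboux {φ : ℝ → ℝ} {C b : ℝ} (hC : ∀ s ∈ Icc 0 b, |φ s| ≤ C)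
    (h : ∀ ε > 0, ∃ n q m r, IsSubdivision 0 b n q ∧ IsSubdivision 0 b m r ∧
      upperDarboux φ n q - lowerDarboux φ m r < ε) :
    ∀ᵐ s, s ∈ Ioo 0 b → ContinuousAt φ s := by
  have h' : ∀ k : ℕ, ∃ n q m r, IsSubdivision 0 b n q ∧ IsSubdivision 0 b m r ∧
      upperDarboux φ n q - lowerDarboux φ m r < 1 / ((k : ℝ) + 1) := fun k =>
    h _ (by positivity)
  choose n q m r hq hr hk using h'
  set u : ℕ → ℝ → ℝ := fun k => stepFun (n k) (q k) (fun i => sSup (φ '' Icc (q k i) (q k (i + 1))))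
    with hu
  set v : ℕ → ℝ → ℝ := fun k => stepFun (m k) (r k) (fun i => sInf (φ '' Icc (r k i) (r k (i + 1))))
    with hv
  have huφ : ∀ k, ∀ s ∈ Ioc 0 b, φ s ≤ u k s := by
    intro k s hs
    obtain ⟨i, hi, his⟩ := exists_mem_Ioc_of_isSubdivision (hq k) hs
    simp only [hu, stepFun_eq (hq k) _ hi his]
    exact le_csSup (bddAbove_image_piece hC (hq k) hi) (mem_image_of_mem _ (Ioc_subset_Icc_self his))
  have hvφ : ∀ k, ∀ s ∈ Ioc 0 b, v k s ≤ φ s := by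
    intro k s hs
    obtain ⟨i, hi, his⟩ := exists_mem_Ioc_of_isSubdivision (hr k) hs
    simp only [hv, stepFun_eq (hr k) _ hi his]
    exact csInf_le (bddBelow_image_piece hC (hr k) hi) (mem_image_of_mem _ (Ioc_subset_Icc_self his))
  have hint : ∀ k, ∫⁻ s in Ioc 0 b, ENNReal.ofReal (u k s - v k s) ≤
      ENNReal.ofReal (1 / ((k : ℝ) + 1)) := by
    intro k
    have hui : IntegrableOn (u k) (Ioc 0 b) := integrableOn_stepFun _ _ _ _ _
    have hvi : IntegrableOn (v k) (Ioc 0 b) := integrableOn_stepFun _ _ _ _ _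
    rw [← ofReal_integral_eq_lintegral_ofReal (f := fun s => u k s - v k s) (hui.sub hvi)]
    · refine ENNReal.ofReal_le_ofReal ?_
      rw [integral_sub hui hvi, setIntegral_stepFun (hq k), setIntegral_stepFun (hr k)]
      exact (hk k).le
    · filter_upwards [ae_restrict_mem measurableSet_Ioc] with s hs
      have := (hvφ k s hs).trans (huφ k s hs)
      simpa using this
  have hmeas : ∀ k, Measurable fun s => ENNReal.ofReal (u k s - v k s) := fun k =>
    ((measurable_stepFun _ _ _).sub (measurable_stepFun _ _ _)).ennreal_ofReal
  have hzero : ∫⁻ s in Ioc 0 b, ⨅ k, ENNReal.ofReal (u k s - v k s) = 0 := by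
    have hle : ∀ k : ℕ, ∫⁻ s in Ioc 0 b, ⨅ k, ENNReal.ofReal (u k s - v k s) ≤
        ENNReal.ofReal (1 / ((k : ℝ) + 1)) := fun k =>
      (lintegral_mono fun s => iInf_le _ k).trans (hint k)
    have ht := ENNReal.tendsto_ofReal (tendsto_one_div_add_atTop_nhds_zero_nat (𝕜 := ℝ))
    rw [ENNReal.ofReal_zero] at ht
    exact le_antisymm (ge_of_tendsto' ht hle) bot_le
  rw [lintegral_eq_zero_iff (Measurable.iInf hmeas),
    Filter.EventuallyEq, ae_restrict_iff' measurableSet_Ioc] at hzero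
  have hcount : (⋃ k, range (q k) ∪ range (r k)).Countable :=
    countable_iUnion fun k => (countable_range _).union (countable_range _)
  filter_upwards [hzero, hcount.ae_notMem volume] with s hs0 hsn hs
  have hs' : s ∈ Ioc 0 b := Ioo_subset_Ioc_self hs
  have hs0 := hs0 hs'
  simp only [mem_iUnion, mem_union, mem_range, not_exists, not_or] at hsn
  rw [Metric.continuousAt_iff']
  intro ε hε
  obtain ⟨k, hkε⟩ : ∃ k, u k s - v k s < ε := by
    by_contra hcon
    push Not at hcon
    have : ENNReal.ofReal ε ≤ ⨅ k, ENNReal.ofReal (u k s - v k s) :=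
      le_iInf fun k => ENNReal.ofReal_le_ofReal (hcon k)
    rw [hs0] at this
    simp only [Pi.zero_apply, nonpos_iff_eq_zero, ENNReal.ofReal_eq_zero] at this
    linarith
  obtain ⟨i, hi, his⟩ := exists_mem_Ioc_of_isSubdivision (hq k) hs'
  obtain ⟨j, hj, hjs⟩ := exists_mem_Ioc_of_isSubdivision (hr k) hs'
  have hi2 : s < q k (i + 1) := lt_of_le_of_ne his.2 (Ne.symm ((hsn k).1 _))
  have hj2 : s < r k (j + 1) := lt_of_le_of_ne hjs.2 (Ne.symm ((hsn k).2 _))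
  filter_upwards [Ioo_mem_nhds his.1 hi2, Ioo_mem_nhds hjs.1 hj2] with x hx1 hx2
  have hx : x ∈ Ioc 0 b := ⟨((hq k).mem_Icc hi.le).1.trans_lt hx1.1,
    hx1.2.le.trans ((hq k).mem_Icc hi).2⟩
  have e1 : u k x = u k s := by
    simp only [hu, stepFun_eq (hq k) _ hi his, stepFun_eq (hq k) _ hi (Ioo_subset_Ioc_self hx1)]
  have e2 : v k x = v k s := by
    simp only [hv, stepFun_eq (hr k) _ hj hjs, stepFun_eq (hr k) _ hj (Ioo_subset_Ioc_self hx2)]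
  rw [Real.dist_eq, abs_lt]
  constructor <;> linarith [huφ k x hx, hvφ k x hx, huφ k s hs', hvφ k s hs']

theorem mem_closure_image_piece {φ : ℝ → ℝ} {C b c : ℝ} (hC : ∀ s ∈ Icc 0 b, |φ s| ≤ C) {n : ℕ}
    {q : ℕ → ℝ} (hq : IsSubdivision 0 b n q) {i : ℕ} (hi : i < n)
    (hc : c ∈ closure (φ '' Icc (q i) (q (i + 1)))) : |c| ≤ C := by
  have : closure (φ '' Icc (q i) (q (i + 1))) ⊆ {x | |x| ≤ C} := by
    refine closure_minimal ?_ (isClosed_le continuous_abs continuous_const)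
    rintro _ ⟨s, hs, rfl⟩
    exact hC s ⟨(hq.mem_Icc hi.le).1.trans hs.1, hs.2.trans (hq.mem_Icc hi).2⟩
  exact this hc

/-- Allowing values in the closure of the image covers tagged sums as well as suprema and infima
over the pieces. -/
theorem tendsto_stepFun {φ : ℝ → ℝ} {b : ℝ} {n : ℕ → ℕ} {q c : ℕ → ℕ → ℝ}
    (hq : ∀ N, IsSubdivision 0 b (n N) (q N))
    (hmesh : ∀ δ > 0, ∀ᶠ N in atTop, ∀ i < n N, q N (i + 1) - q N i < δ)
    (hc : ∀ N, ∀ i < n N, c N i ∈ closure (φ '' Icc (q N i) (q N (i + 1)))) {s : ℝ}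
    (hs : s ∈ Ioo 0 b) (hφ : ContinuousAt φ s) :
    Tendsto (fun N => stepFun (n N) (q N) (c N) s) atTop (𝓝 (φ s)) := by
  rw [Metric.tendsto_nhds]
  intro ε hε
  obtain ⟨δ, hδ, h⟩ := Metric.continuousAt_iff.1 hφ (ε / 2) (by linarith)
  filter_upwards [hmesh δ hδ] with N hN
  obtain ⟨i, hi, his⟩ := exists_mem_Ioc_of_isSubdivision (hq N) (Ioo_subset_Ioc_self hs)
  rw [stepFun_eq (hq N) _ hi his]
  obtain ⟨_, ⟨x, hx, rfl⟩, hxc⟩ := Metric.mem_closure_iff.1 (hc N i hi) (ε / 2) (by linarith)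
  have hxs : dist x s < δ := by
    have := hN i hi
    rw [Real.dist_eq, abs_lt]
    constructor <;> linarith [hx.1, hx.2, his.1, his.2]
  calc dist (c N i) (φ s) ≤ dist (c N i) (φ x) + dist (φ x) (φ s) := dist_triangle _ _ _
    _ < ε / 2 + ε / 2 := add_lt_add hxc (h hxs)
    _ = ε := by ring

theorem eventually_mesh_uniform (b : ℝ) :
    ∀ δ > 0, ∀ᶠ N : ℕ in atTop, ∀ i : ℕ, i < N + 1 →
      (0 + (i + 1 : ℕ) * ((b - 0) / (N + 1))) - (0 + i * ((b - 0) / (N + 1))) < δ := by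
  intro δ hδ
  have ht := (tendsto_one_div_add_atTop_nhds_zero_nat (𝕜 := ℝ)).const_mul b
  rw [mul_zero] at ht
  filter_upwards [ht.eventually (gt_mem_nhds hδ)] with N hN i _
  push_cast
  calc _ = b * (1 / ((N : ℝ) + 1)) := by ring
    _ < δ := hN

theorem ae_Ioc_of_ae_Ioo {p : ℝ → Prop} {b : ℝ} (h : ∀ᵐ s, s ∈ Ioo 0 b → p s) :
    ∀ᵐ s ∂(volume.restrict (Ioc 0 b)), p s := by
  rw [← Measure.restrict_congr_set Ioo_ae_eq_Ioc, ae_restrict_iff' measurableSet_Ioo]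
  exact h

theorem IsRiemann.aestronglyMeasurable {φ : ℝ → ℝ} {b : ℝ} (hb : 0 ≤ b) (h : IsRiemann φ b) :
    AEStronglyMeasurable φ (volume.restrict (Ioc 0 b)) := by
  set q : ℕ → ℕ → ℝ := fun N i => 0 + i * ((b - 0) / (N + 1)) with hq
  have hsub : ∀ N, IsSubdivision 0 b (N + 1) (q N) := fun N => isSubdivision_uniform hb N
  refine aestronglyMeasurable_of_tendsto_ae atTop
    (f := fun N : ℕ => stepFun (N + 1) (q N) (fun i => φ (q N i)))
    (fun N => (measurable_stepFun _ _ _).aestronglyMeasurable) (ae_Ioc_of_ae_Ioo ?_)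
  filter_upwards [h.2] with s hs hs'
  refine tendsto_stepFun hsub (eventually_mesh_uniform b) (fun N i hi => ?_) hs' (hs hs')
  exact subset_closure (mem_image_of_mem _ (left_mem_Icc.2 ((hsub N).2.2 i hi)))

theorem IsRiemann.integrableOn {φ : ℝ → ℝ} {b : ℝ} (hb : 0 ≤ b) (h : IsRiemann φ b) :
    IntegrableOn φ (Ioc 0 b) := by
  obtain ⟨C, hC⟩ := h.1
  refine (integrable_const C).mono' (h.aestronglyMeasurable hb) ?_
  filter_upwards [ae_restrict_mem measurableSet_Ioc] with s hs
  exact hC s (Ioc_subset_Icc_self hs)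

theorem IsRiemann.tendsto_sum {φ : ℝ → ℝ} {b : ℝ} (h : IsRiemann φ b)
    {n : ℕ → ℕ} {q c : ℕ → ℕ → ℝ}
    (hq : ∀ N, IsSubdivision 0 b (n N) (q N))
    (hmesh : ∀ δ > 0, ∀ᶠ N in atTop, ∀ i < n N, q N (i + 1) - q N i < δ)
    (hc : ∀ N, ∀ i < n N, c N i ∈ closure (φ '' Icc (q N i) (q N (i + 1)))) :
    Tendsto (fun N => ∑ i ∈ Finset.range (n N), c N i * (q N (i + 1) - q N i)) atTop
      (𝓝 (∫ s in Ioc 0 b, φ s)) := by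
  obtain ⟨C, hC⟩ := h.1
  have : ∀ N, ∑ i ∈ Finset.range (n N), c N i * (q N (i + 1) - q N i) =
      ∫ s in Ioc 0 b, stepFun (n N) (q N) (c N) s := fun N => (setIntegral_stepFun (hq N) _).symm
  simp only [this]
  refine tendsto_integral_of_dominated_convergence (fun _ => C)
    (fun N => (measurable_stepFun _ _ _).aestronglyMeasurable) (by simp) (fun N => ?_)
    (ae_Ioc_of_ae_Ioo ?_)
  · filter_upwards [ae_restrict_mem measurableSet_Ioc] with s hs
    obtain ⟨i, hi, his⟩ := exists_mem_Ioc_of_isSubdivision (hq N) hs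
    rw [stepFun_eq (hq N) _ hi his]
    exact mem_closure_image_piece hC (hq N) hi (hc N i hi)
  · filter_upwards [h.2] with s hs hs'
    exact tendsto_stepFun hq hmesh hc hs' (hs hs')

theorem IsRiemann.integral_le_upperDarboux {φ : ℝ → ℝ} {b : ℝ} (hb : 0 ≤ b) (h : IsRiemann φ b)
    {n : ℕ} {q : ℕ → ℝ} (hq : IsSubdivision 0 b n q) :
    ∫ s in Ioc 0 b, φ s ≤ upperDarboux φ n q := by
  obtain ⟨C, hC⟩ := h.1
  rw [upperDarboux, ← setIntegral_stepFun hq]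
  refine setIntegral_mono_on (h.integrableOn hb) (integrableOn_stepFun _ _ _ _ _)
    measurableSet_Ioc fun s hs => ?_
  obtain ⟨i, hi, his⟩ := exists_mem_Ioc_of_isSubdivision hq hs
  rw [stepFun_eq hq _ hi his]
  exact le_csSup (bddAbove_image_piece hC hq hi) (mem_image_of_mem _ (Ioc_subset_Icc_self his))

theorem IsRiemann.lowerDarboux_le_integral {φ : ℝ → ℝ} {b : ℝ} (hb : 0 ≤ b) (h : IsRiemann φ b)
    {n : ℕ} {q : ℕ → ℝ} (hq : IsSubdivision 0 b n q) :
    lowerDarboux φ n q ≤ ∫ s in Ioc 0 b, φ s := by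
  obtain ⟨C, hC⟩ := h.1
  rw [lowerDarboux, ← setIntegral_stepFun hq]
  refine setIntegral_mono_on (integrableOn_stepFun _ _ _ _ _) (h.integrableOn hb)
    measurableSet_Ioc fun s hs => ?_
  obtain ⟨i, hi, his⟩ := exists_mem_Ioc_of_isSubdivision hq hs
  rw [stepFun_eq hq _ hi his]
  exact csInf_le (bddBelow_image_piece hC hq hi) (mem_image_of_mem _ (Ioc_subset_Icc_self his))

/-! ### Transfer of the F^α-integral to the Riemann integral -/

section Staircase

variable {F : Set ℝ} (hF : IsClosed F) {α : ℝ} (hα : 0 < α) {l : ℝ}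
  (hfin : ∀ x y : ℝ, x ≤ y → mass F α x y ≠ ⊤) (hzero : staircase F α l 0 = 0)

include hα hfin hzero in
theorem IsSubdivision.staircase_comp {b : ℝ} {n : ℕ} {p : ℕ → ℝ} (hp : IsSubdivision 0 b n p) :
    IsSubdivision 0 (staircase F α l b) n (fun i => staircase F α l (p i)) :=
  ⟨by simp only [hp.1, hzero], by simp only [hp.2.1],
    fun i hi => monotone_staircase hα l hfin (hp.2.2 i hi)⟩

include hF hα hfin in
theorem image_inter_Icc {h φ : ℝ → ℝ} (hh : ∀ t, 0 ≤ t → h t = φ (staircase F α l t)) {u w : ℝ}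
    (hu : 0 ≤ u) (hS : staircase F α l u < staircase F α l w) :
    h '' (F ∩ Icc u w) = φ '' Icc (staircase F α l u) (staircase F α l w) := by
  rw [← staircase_image hF hα l hfin hS, image_image]
  exact image_congr fun t ht => hh t (hu.trans ht.2.1)

include hF hα hfin in
theorem upperSum_eq {h φ : ℝ → ℝ} (hh : ∀ t, 0 ≤ t → h t = φ (staircase F α l t)) {b : ℝ} {n : ℕ}
    {p : ℕ → ℝ} (hp : IsSubdivision 0 b n p) :
    upperSum F α l h n p = upperDarboux φ n (fun i => staircase F α l (p i)) := by
  refine Finset.sum_congr rfl fun i hi => ?_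
  have hi := Finset.mem_range.1 hi
  rcases (monotone_staircase hα l hfin (hp.2.2 i hi)).lt_or_eq with hS | hS
  · rw [image_inter_Icc hF hα hfin hh (hp.mem_Icc hi.le).1 hS]
  -- The increment is 0, so the supremum is irrelevant, even where `F` misses the piece and it takes
  -- its default value.
  · simp [hS]

include hF hα hfin in
theorem lowerSum_eq {h φ : ℝ → ℝ} (hh : ∀ t, 0 ≤ t → h t = φ (staircase F α l t)) {b : ℝ} {n : ℕ}
    {p : ℕ → ℝ} (hp : IsSubdivision 0 b n p) :
    lowerSum F α l h n p = lowerDarboux φ n (fun i => staircase F α l (p i)) := by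
  refine Finset.sum_congr rfl fun i hi => ?_
  have hi := Finset.mem_range.1 hi
  rcases (monotone_staircase hα l hfin (hp.2.2 i hi)).lt_or_eq with hS | hS
  · rw [image_inter_Icc hF hα hfin hh (hp.mem_Icc hi.le).1 hS]
  · simp [hS]

include hF hα hfin hzero in
theorem isRiemann_of_integrable {h φ : ℝ → ℝ} (hh : ∀ t, 0 ≤ t → h t = φ (staircase F α l t))
    {b : ℝ} (hb : 0 ≤ b) (hint : Integrable F α l h 0 b) : IsRiemann φ (staircase F α l b) := by
  have hmono := monotone_staircase hα l hfin
  have hSb : 0 ≤ staircase F α l b := hzero ▸ hmono hb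
  rcases hSb.lt_or_eq with hpos | h0
  · obtain ⟨⟨C, hC⟩, heq⟩ := hint
    have himg := image_inter_Icc hF hα hfin hh le_rfl (hzero.symm ▸ hpos)
    rw [hzero] at himg
    have hCφ : ∀ s ∈ Icc 0 (staircase F α l b), |φ s| ≤ C := by
      intro s hs
      obtain ⟨t, ht, hts⟩ : φ s ∈ h '' (F ∩ Icc 0 b) := himg ▸ mem_image_of_mem φ hs
      rw [← hts]
      exact hC t ht
    refine ⟨⟨C, hCφ⟩, ae_continuousAt_of_darboux hCφ fun ε hε => ?_⟩
    have hne1 : {u | ∃ n p, IsSubdivision 0 b n p ∧ upperSum F α l h n p = u}.Nonempty :=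
      ⟨_, _, _, isSubdivision_uniform hb 0, rfl⟩
    have hne2 : {u | ∃ n p, IsSubdivision 0 b n p ∧ lowerSum F α l h n p = u}.Nonempty :=
      ⟨_, _, _, isSubdivision_uniform hb 0, rfl⟩
    obtain ⟨_, ⟨n, p, hp, rfl⟩, hp'⟩ := exists_lt_of_csInf_lt hne1
      (show upperIntegral F α l h 0 b < upperIntegral F α l h 0 b + ε / 2 by linarith)
    obtain ⟨_, ⟨m, r, hr, rfl⟩, hr'⟩ := exists_lt_of_lt_csSup hne2
      (show lowerIntegral F α l h 0 b - ε / 2 < lowerIntegral F α l h 0 b by linarith)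
    refine ⟨n, _, m, _, hp.staircase_comp hα hfin hzero, hr.staircase_comp hα hfin hzero, ?_⟩
    rw [← upperSum_eq hF hα hfin hh hp, ← lowerSum_eq hF hα hfin hh hr]
    linarith
  -- If `S(b) = 0`, the target interval is the single point 0 and its interior is empty.
  · rw [← h0]
    refine ⟨⟨|φ 0|, fun s hs => ?_⟩, ae_of_all _ fun s hs => absurd (hs.1.trans hs.2) (lt_irrefl _)⟩
    rw [le_antisymm hs.2 hs.1]

include hα hfin in
theorem eventually_mesh_staircase {b : ℝ} (hb : 0 ≤ b) :
    ∀ δ > 0, ∀ᶠ N : ℕ in atTop, ∀ i : ℕ, i < N + 1 →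
      staircase F α l (0 + (i + 1 : ℕ) * ((b - 0) / (N + 1))) -
        staircase F α l (0 + i * ((b - 0) / (N + 1))) < δ := by
  intro δ hδ
  have huc := isCompact_Icc.uniformContinuousOn_of_continuous
    (continuous_staircase (F := F) hα l hfin).continuousOn (s := Icc 0 b)
  obtain ⟨η, hη, h⟩ := Metric.uniformContinuousOn_iff.1 huc δ hδ
  filter_upwards [eventually_mesh_uniform b η hη] with N hN i hi
  have hp := isSubdivision_uniform hb N
  have := h _ (hp.mem_Icc (show i + 1 ≤ N + 1 from hi)) _ (hp.mem_Icc hi.le) (by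
    rw [Real.dist_eq, abs_of_nonneg (sub_nonneg.2 (hp.2.2 i hi))]
    exact hN i hi)
  exact (le_abs_self _).trans_lt this

include hF hα hfin hzero in
-- The Lebesgue integral of `φ` separates lower from upper sums. The images of uniform subdivisions
-- have mesh tending to 0, by uniform continuity of the staircase, so both kinds of sums along them
-- converge to it.
theorem lowerIntegral_and_upperIntegral_eq {h φ : ℝ → ℝ}
    (hh : ∀ t, 0 ≤ t → h t = φ (staircase F α l t)) {b : ℝ} (hb : 0 ≤ b)
    (hφ : IsRiemann φ (staircase F α l b)) :
    lowerIntegral F α l h 0 b = ∫ s in 0..staircase F α l b, φ s ∧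
      upperIntegral F α l h 0 b = ∫ s in 0..staircase F α l b, φ s := by
  have hSb : 0 ≤ staircase F α l b := hzero ▸ monotone_staircase hα l hfin hb
  rw [intervalIntegral.integral_of_le hSb]
  obtain ⟨C, hC⟩ := hφ.1
  have hp := fun N => isSubdivision_uniform hb N
  have hq := fun N => (hp N).staircase_comp hα hfin hzero
  have hmesh := eventually_mesh_staircase (F := F) (l := l) hα hfin hb
  have hup : ∀ u ∈ {u | ∃ n p, IsSubdivision 0 b n p ∧ upperSum F α l h n p = u},
      ∫ s in Ioc 0 (staircase F α l b), φ s ≤ u := by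
    rintro _ ⟨n, p, hp, rfl⟩
    rw [upperSum_eq hF hα hfin hh hp]
    exact hφ.integral_le_upperDarboux hSb (hp.staircase_comp hα hfin hzero)
  have hlow : ∀ u ∈ {u | ∃ n p, IsSubdivision 0 b n p ∧ lowerSum F α l h n p = u},
      u ≤ ∫ s in Ioc 0 (staircase F α l b), φ s := by
    rintro _ ⟨n, p, hp, rfl⟩
    rw [lowerSum_eq hF hα hfin hh hp]
    exact hφ.lowerDarboux_le_integral hSb (hp.staircase_comp hα hfin hzero)
  have hne : ∀ N i : ℕ, i < N + 1 → (φ '' Icc (staircase F α l (0 + i * ((b - 0) / (N + 1))))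
      (staircase F α l (0 + (i + 1 : ℕ) * ((b - 0) / (N + 1))))).Nonempty := fun N i hi =>
    (nonempty_Icc.2 ((hq N).2.2 i hi)).image _
  have htu := hφ.tendsto_sum (n := fun N => N + 1) hq hmesh
    (c := fun N i => sSup (φ '' Icc (staircase F α l (0 + i * ((b - 0) / ((N : ℕ) + 1))))
      (staircase F α l (0 + (i + 1 : ℕ) * ((b - 0) / (N + 1))))))
    fun N i hi => csSup_mem_closure (hne N i hi) (bddAbove_image_piece hC (hq N) hi)
  have htl := hφ.tendsto_sum (n := fun N => N + 1) hq hmesh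
    (c := fun N i => sInf (φ '' Icc (staircase F α l (0 + i * ((b - 0) / ((N : ℕ) + 1))))
      (staircase F α l (0 + (i + 1 : ℕ) * ((b - 0) / (N + 1))))))
    fun N i hi => csInf_mem_closure (hne N i hi) (bddBelow_image_piece hC (hq N) hi)
  constructor
  · apply le_antisymm
    · exact csSup_le ⟨_, _, _, hp 0, rfl⟩ hlow
    · refine le_of_tendsto' htl fun N => le_csSup ⟨_, hlow⟩ ⟨_, _, hp N, ?_⟩
      exact lowerSum_eq hF hα hfin hh (hp N)
  · apply le_antisymm
    · refine ge_of_tendsto' htu fun N => csInf_le ⟨_, hup⟩ ⟨_, _, hp N, ?_⟩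
      exact upperSum_eq hF hα hfin hh (hp N)
    · exact le_csInf ⟨_, _, _, hp 0, rfl⟩ hup

include hF hα hfin hzero in
theorem integrable_iff_isRiemann {h φ : ℝ → ℝ} (hh : ∀ t, 0 ≤ t → h t = φ (staircase F α l t))
    {b : ℝ} (hb : 0 ≤ b) : Integrable F α l h 0 b ↔ IsRiemann φ (staircase F α l b) := by
  refine ⟨isRiemann_of_integrable hF hα hfin hzero hh hb, fun hφ => ⟨?_, ?_⟩⟩
  · obtain ⟨C, hC⟩ := hφ.1
    refine ⟨C, fun t ht => ?_⟩
    rw [hh t ht.2.1]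
    have hmono := monotone_staircase hα l hfin
    exact hC _ ⟨hzero ▸ hmono ht.2.1, hmono ht.2.2⟩
  · obtain ⟨h1, h2⟩ := lowerIntegral_and_upperIntegral_eq hF hα hfin hzero hh hb hφ
    rw [h1, h2]

include hF hα hfin hzero in
theorem integral_eq_intervalIntegral {h φ : ℝ → ℝ}
    (hh : ∀ t, 0 ≤ t → h t = φ (staircase F α l t)) {b : ℝ} (hb : 0 ≤ b)
    (hφ : IsRiemann φ (staircase F α l b)) :
    integral F α l h 0 b = ∫ s in 0..staircase F α l b, φ s :=
  (lowerIntegral_and_upperIntegral_eq hF hα hfin hzero hh hb hφ).2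

end Staircase

/-! ### Stability of Riemann integrability -/

theorem IsRiemann.mono {φ : ℝ → ℝ} {b c : ℝ} (h : IsRiemann φ b) (hc : c ≤ b) :
    IsRiemann φ c := by
  obtain ⟨⟨C, hC⟩, h2⟩ := h
  refine ⟨⟨C, fun s hs => hC s ⟨hs.1, hs.2.trans hc⟩⟩, ?_⟩
  filter_upwards [h2] with s hs hs'
  exact hs ⟨hs'.1, hs'.2.trans_le hc⟩

theorem IsRiemann.intervalIntegrable {φ : ℝ → ℝ} {b : ℝ} (hb : 0 ≤ b) (h : IsRiemann φ b) :
    IntervalIntegrable φ volume 0 b :=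
  (intervalIntegrable_iff_integrableOn_Ioc_of_le hb).2 (h.integrableOn hb)

theorem IsRiemann.of_continuous_eqOn {φ K : ℝ → ℝ} {b : ℝ} (hK : Continuous K)
    (h : ∀ s ∈ Icc 0 b, φ s = K s) : IsRiemann φ b := by
  obtain ⟨C, hC⟩ := isCompact_Icc.exists_bound_of_continuousOn (hK.continuousOn (s := Icc 0 b))
  refine ⟨⟨C, fun s hs => by rw [h s hs]; exact hC s hs⟩, ae_of_all _ fun s hs => ?_⟩
  refine hK.continuousAt.congr ?_
  filter_upwards [Ioo_mem_nhds hs.1 hs.2] with x hx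
  exact (h x (Ioo_subset_Icc_self hx)).symm

theorem IsRiemann.mul {φ ψ : ℝ → ℝ} {b : ℝ} (hφ : IsRiemann φ b) (hψ : IsRiemann ψ b) :
    IsRiemann (fun s => φ s * ψ s) b := by
  obtain ⟨⟨C, hC⟩, h1⟩ := hφ
  obtain ⟨⟨D, hD⟩, h2⟩ := hψ
  refine ⟨⟨C * D, fun s hs => ?_⟩, ?_⟩
  · rw [abs_mul]
    exact mul_le_mul (hC s hs) (hD s hs) (abs_nonneg _) ((abs_nonneg _).trans (hC s hs))
  · filter_upwards [h1, h2] with s hs1 hs2 hs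
    exact (hs1 hs).mul (hs2 hs)

theorem IsRiemann.comp_sub_left {φ : ℝ → ℝ} {x : ℝ} (hφ : IsRiemann φ x) :
    IsRiemann (fun r => φ (x - r)) x := by
  obtain ⟨⟨C, hC⟩, h1⟩ := hφ
  refine ⟨⟨C, fun s hs => hC _ ⟨by linarith [hs.2], by linarith [hs.1]⟩⟩, ?_⟩
  filter_upwards [(Measure.measurePreserving_sub_left volume x).quasiMeasurePreserving.ae h1]
    with r hr hr'
  exact ContinuousAt.comp (f := fun r => x - r) (hr ⟨by linarith [hr'.2], by linarith [hr'.1]⟩)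
    (by fun_prop)

theorem isRiemann_const (c b : ℝ) : IsRiemann (fun _ => c) b :=
  IsRiemann.of_continuous_eqOn continuous_const fun _ _ => rfl

/-! ### Convolutions and primitives on the half-line -/

/-- The convolution `∫_0^x φ(x - r) ψ(r) dr`. -/
noncomputable def realConv (φ ψ : ℝ → ℝ) (x : ℝ) : ℝ := ∫ r in 0..x, φ (x - r) * ψ r

/-- The primitive of `φ` that vanishes at `0`. -/
noncomputable def primitive (φ : ℝ → ℝ) (x : ℝ) : ℝ := ∫ r in 0..x, φ r

theorem realConv_comm (φ ψ : ℝ → ℝ) (x : ℝ) : realConv φ ψ x = realConv ψ φ x := by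
  unfold realConv
  have := intervalIntegral.integral_comp_sub_left (a := 0) (b := x)
    (fun r => φ (x - r) * ψ r) x
  simp only [sub_zero, sub_self, sub_sub_cancel] at this
  rw [← this]
  exact intervalIntegral.integral_congr fun r _ => mul_comm _ _

theorem realConv_one (φ : ℝ → ℝ) (x : ℝ) : realConv (fun _ => 1) φ x = primitive φ x := by
  simp [realConv, primitive]

/-- The restriction of `φ` to `(0, b)`, extended by zero. -/
noncomputable def trunc (φ : ℝ → ℝ) (b : ℝ) : ℝ → ℝ := (Ioo 0 b).indicator φ

theorem trunc_of_mem {φ : ℝ → ℝ} {b s : ℝ} (h1 : 0 < s) (h2 : s < b) : trunc φ b s = φ s :=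
  indicator_of_mem (show s ∈ Ioo 0 b from ⟨h1, h2⟩) _

theorem trunc_of_nonpos {φ : ℝ → ℝ} {b s : ℝ} (h : s ≤ 0) : trunc φ b s = 0 :=
  indicator_of_notMem (fun hs : s ∈ Ioo 0 b => absurd hs.1 (not_lt.2 h)) _

theorem IsRiemann.integrable_trunc {φ : ℝ → ℝ} {b : ℝ} (hb : 0 ≤ b) (h : IsRiemann φ b) :
    MeasureTheory.Integrable (trunc φ b) :=
  (integrable_indicator_iff measurableSet_Ioo).2
    ((h.integrableOn hb).mono_set Ioo_subset_Ioc_self)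

theorem IsRiemann.exists_abs_trunc_le {φ : ℝ → ℝ} {b : ℝ} (h : IsRiemann φ b) :
    ∃ C, ∀ s, |trunc φ b s| ≤ C := by
  obtain ⟨C, hC⟩ := h.1
  refine ⟨max C 0, fun s => ?_⟩
  by_cases hs : s ∈ Ioo 0 b
  · rw [trunc, indicator_of_mem hs]
    exact (hC s (Ioo_subset_Icc_self hs)).trans (le_max_left _ _)
  · rw [trunc, indicator_of_notMem hs]
    simp

theorem IsRiemann.ae_continuousAt_trunc {φ : ℝ → ℝ} {b : ℝ} (h : IsRiemann φ b) :
    ∀ᵐ s, ContinuousAt (trunc φ b) s := by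
  have hfin : ({0, b} : Set ℝ).Countable := by simp
  filter_upwards [h.2, hfin.ae_notMem volume] with s hs hs'
  simp only [mem_insert_iff, mem_singleton_iff, not_or] at hs'
  by_cases hmem : s ∈ Ioo 0 b
  · refine (hs hmem).congr ?_
    filter_upwards [Ioo_mem_nhds hmem.1 hmem.2] with x hx
    exact (indicator_of_mem hx _).symm
  · have : s ∈ (Icc 0 b)ᶜ := fun hs2 => hmem
      ⟨lt_of_le_of_ne hs2.1 (Ne.symm hs'.1), lt_of_le_of_ne hs2.2 hs'.2⟩
    refine (continuousAt_const (y := (0 : ℝ))).congr ?_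
    filter_upwards [isClosed_Icc.isOpen_compl.mem_nhds this] with x hx
    exact (indicator_of_notMem (fun h => hx (Ioo_subset_Icc_self h)) _).symm

theorem IsRiemann.primitive {φ : ℝ → ℝ} {b : ℝ} (hb : 0 ≤ b) (h : IsRiemann φ b) :
    IsRiemann (primitive φ) b := by
  refine IsRiemann.of_continuous_eqOn (K := fun y => ∫ r in 0..y, (Ioc 0 b).indicator φ r) ?_ ?_
  · have : MeasureTheory.Integrable ((Ioc 0 b).indicator φ) :=
      (integrable_indicator_iff measurableSet_Ioc).2 (h.integrableOn hb)
    exact intervalIntegral.continuous_primitive (fun _ _ => this.intervalIntegrable) 0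
  · intro s hs
    refine intervalIntegral.integral_congr_ae (ae_of_all _ fun r hr => ?_)
    rw [uIoc_of_le hs.1] at hr
    exact (indicator_of_mem (show r ∈ Ioc 0 b from ⟨hr.1, hr.2.trans hs.2⟩) _).symm

/-- With a truncation level `b` independent of `x`, the variable limit of integration disappears,
which suits dominated convergence and Fubini. -/
theorem realConv_eq_integral_trunc (φ ψ : ℝ → ℝ) {b x : ℝ} (hx : 0 ≤ x) (hxb : x ≤ b) :
    realConv φ ψ x = ∫ r, trunc φ b (x - r) * trunc ψ b r := by
  rw [realConv, intervalIntegral.integral_of_le hx, integral_Ioc_eq_integral_Ioo,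
    ← integral_indicator measurableSet_Ioo]
  congr 1
  funext r
  by_cases hr : r ∈ Ioo 0 x
  · rw [indicator_of_mem hr, trunc_of_mem hr.1 (hr.2.trans_le hxb),
      trunc_of_mem (by linarith [hr.2]) (by linarith [hr.1])]
  · rw [indicator_of_notMem hr]
    rcases le_or_gt r 0 with h | h
    · rw [trunc_of_nonpos h, mul_zero]
    · rw [trunc_of_nonpos (s := x - r), zero_mul]
      by_contra h'
      exact hr ⟨h, by linarith⟩

/-- For fixed `x₀`, almost every `r` makes `x₀ - r` a continuity point of the truncated `φ`;
boundedness of one factor and integrability of the other give the domination. -/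
theorem IsRiemann.continuous_integral_trunc {φ ψ : ℝ → ℝ} {b : ℝ} (hb : 0 ≤ b)
    (hφ : IsRiemann φ b) (hψ : IsRiemann ψ b) :
    Continuous fun x => ∫ r, trunc φ b (x - r) * trunc ψ b r := by
  obtain ⟨C, hC⟩ := hφ.exists_abs_trunc_le
  have hmp := fun x : ℝ => (Measure.measurePreserving_sub_left volume x).quasiMeasurePreserving
  rw [continuous_iff_continuousAt]
  intro x₀
  refine continuousAt_of_dominated (bound := fun r => C * |trunc ψ b r|)
    (Eventually.of_forall fun x => ?_) (Eventually.of_forall fun x => ae_of_all _ fun r => ?_)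
    ((hψ.integrable_trunc hb).abs.const_mul C) ?_
  · exact ((hφ.integrable_trunc hb).aestronglyMeasurable.comp_quasiMeasurePreserving (hmp x)).mul
      (hψ.integrable_trunc hb).aestronglyMeasurable
  · rw [Real.norm_eq_abs, abs_mul]
    exact mul_le_mul_of_nonneg_right (hC _) (abs_nonneg _)
  · filter_upwards [(hmp x₀).ae hφ.ae_continuousAt_trunc] with r hr
    exact (ContinuousAt.comp (f := fun x => x - r) hr (by fun_prop)).mul continuousAt_const

theorem IsRiemann.realConv {φ ψ : ℝ → ℝ} {b : ℝ} (hb : 0 ≤ b) (hφ : IsRiemann φ b)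
    (hψ : IsRiemann ψ b) : IsRiemann (realConv φ ψ) b :=
  IsRiemann.of_continuous_eqOn (hφ.continuous_integral_trunc hb hψ) fun _ hs =>
    realConv_eq_integral_trunc φ ψ hs.1 hs.2

theorem integral_trunc_sub (φ : ℝ → ℝ) {b x r : ℝ} (hφ : IsRiemann φ b) (hr : 0 < r) (hrx : r ≤ x)
    (hxb : x ≤ b) : ∫ y in 0..x, trunc φ b (y - r) = primitive φ (x - r) := by
  have hi := hφ.integrable_trunc (hr.le.trans (hrx.trans hxb))
  rw [intervalIntegral.integral_comp_sub_right, ← intervalIntegral.integral_add_adjacent_intervals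
    (b := 0) hi.intervalIntegrable hi.intervalIntegrable]
  have h1 : ∫ y in (0 - r)..0, trunc φ b y = 0 := by
    refine intervalIntegral.integral_zero_ae (ae_of_all _ fun y hy => ?_)
    rw [uIoc_of_le (by linarith)] at hy
    exact trunc_of_nonpos hy.2
  rw [h1, zero_add]
  refine intervalIntegral.integral_congr_ae (ae_of_all _ fun y hy => ?_)
  rw [uIoc_of_le (by linarith)] at hy
  exact trunc_of_mem hy.1 (by linarith [hy.2])

/-- Fubini: integrating `φ(y - r)` over `y ≤ x` first produces the primitive at `x - r`. -/
theorem primitive_realConv {φ ψ : ℝ → ℝ} {x : ℝ} (hx : 0 ≤ x) (hφ : IsRiemann φ x)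
    (hψ : IsRiemann ψ x) : primitive (realConv φ ψ) x = realConv (primitive φ) ψ x := by
  have hint : MeasureTheory.Integrable
      (Function.uncurry fun y r => trunc φ x (y - r) * trunc ψ x r)
      ((volume.restrict (Ioc 0 x)).prod volume) := by
    have := (hψ.integrable_trunc hx).convolution_integrand (ContinuousLinearMap.mul ℝ ℝ)
      (hφ.integrable_trunc hx) (μ := volume) (ν := volume)
    have h2 : MeasureTheory.Integrable
        (Function.uncurry fun y r => trunc φ x (y - r) * trunc ψ x r) (volume.prod volume) := by
      refine this.congr (ae_of_all _ fun p => ?_)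
      simp [Function.uncurry, mul_comm]
    exact h2.mono_measure (Measure.prod_mono Measure.restrict_le_self le_rfl)
  calc primitive (realConv φ ψ) x
      = ∫ y in Ioc 0 x, ∫ r, trunc φ x (y - r) * trunc ψ x r := by
        rw [primitive, intervalIntegral.integral_of_le hx]
        exact setIntegral_congr_fun measurableSet_Ioc fun y hy =>
          realConv_eq_integral_trunc φ ψ hy.1.le hy.2
    _ = ∫ r, ∫ y in Ioc 0 x, trunc φ x (y - r) * trunc ψ x r := integral_integral_swap hint
    _ = ∫ r, (Ioo 0 x).indicator (fun r => primitive φ (x - r) * ψ r) r := by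
        congr 1
        funext r
        rw [integral_mul_const]
        by_cases hr : r ∈ Ioo 0 x
        · rw [indicator_of_mem hr, trunc_of_mem hr.1 hr.2, ← intervalIntegral.integral_of_le hx,
            integral_trunc_sub φ hφ hr.1 hr.2.le le_rfl]
        · rw [indicator_of_notMem hr, trunc, trunc, indicator_of_notMem (f := ψ) hr, mul_zero]
    _ = realConv (primitive φ) ψ x := by
        rw [integral_indicator measurableSet_Ioo, ← integral_Ioc_eq_integral_Ioo,
          ← intervalIntegral.integral_of_le hx, realConv]

/-! ### The theorems of Abel and Mertens for integrals -/

theorem exists_bound_of_tendsto {G : ℝ → ℝ} {A : ℝ} (hG : ∀ b, 0 ≤ b → IsRiemann G b)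
    (hA : Tendsto G atTop (𝓝 A)) : ∃ M, ∀ y, 0 ≤ y → |G y| ≤ M := by
  have h1 : ∀ᶠ y in atTop, |G y| < |A| + 1 :=
    (hA.abs).eventually (gt_mem_nhds (by linarith))
  obtain ⟨N, hN⟩ := eventually_atTop.1 h1
  obtain ⟨C, hC⟩ := (hG (max N 0) (le_max_right _ _)).1
  refine ⟨max C (|A| + 1), fun y hy => ?_⟩
  rcases le_total y (max N 0) with h | h
  · exact (hC y ⟨hy, h⟩).trans (le_max_left _ _)
  · exact (hN y ((le_max_left _ _).trans h)).le.trans (le_max_right _ _)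

/-- The substitution `r = x * u` turns the mean into the integral of `G(x(1 - u)) H(xu)` over `(0,
1]`, whose integrand is bounded and tends to `A * B` for `0 < u < 1`. -/
theorem tendsto_realConv_div {G H : ℝ → ℝ} {A B : ℝ} (hG : ∀ b, 0 ≤ b → IsRiemann G b)
    (hH : ∀ b, 0 ≤ b → IsRiemann H b) (hA : Tendsto G atTop (𝓝 A)) (hB : Tendsto H atTop (𝓝 B)) :
    Tendsto (fun x => x⁻¹ * realConv G H x) atTop (𝓝 (A * B)) := by
  obtain ⟨M, hM⟩ := exists_bound_of_tendsto hG hA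
  obtain ⟨M', hM'⟩ := exists_bound_of_tendsto hH hB
  have hscale : ∀ᶠ x : ℝ in atTop,
      ∫ u in Ioc (0 : ℝ) 1, G (x - x * u) * H (x * u) = x⁻¹ * realConv G H x := by
    filter_upwards [eventually_gt_atTop 0] with x hx
    have := intervalIntegral.smul_integral_comp_mul_left (a := 0) (b := 1)
      (fun r => G (x - r) * H r) x
    rw [mul_zero, mul_one, smul_eq_mul] at this
    rw [realConv, ← this, intervalIntegral.integral_of_le zero_le_one, ← mul_assoc,
      inv_mul_cancel₀ hx.ne', one_mul]
  refine Tendsto.congr' hscale ?_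
  have hAB : A * B = ∫ _ in Ioc (0 : ℝ) 1, A * B := by simp
  rw [hAB]
  refine tendsto_integral_filter_of_dominated_convergence (fun _ => M * M') ?_ ?_
    (integrable_const _) ?_
  · filter_upwards [eventually_gt_atTop 0] with x hx
    have h := ((hG x hx.le).comp_sub_left.mul (hH x hx.le)).intervalIntegrable hx.le
    have h2 := h.comp_mul_left (c := x)
    rw [zero_div, div_self hx.ne', intervalIntegrable_iff_integrableOn_Ioc_of_le zero_le_one] at h2
    exact h2.aestronglyMeasurable
  · filter_upwards [eventually_gt_atTop 0] with x hx
    filter_upwards [ae_restrict_mem measurableSet_Ioc] with u hu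
    have h0 : 0 ≤ x * u := mul_nonneg hx.le hu.1.le
    have h1 : 0 ≤ x - x * u := by nlinarith [hu.2]
    rw [Real.norm_eq_abs, abs_mul]
    exact mul_le_mul (hM _ h1) (hM' _ h0) (abs_nonneg _) ((abs_nonneg _).trans (hM _ h1))
  · rw [← restrict_Ioo_eq_restrict_Ioc]
    filter_upwards [ae_restrict_mem measurableSet_Ioo] with u hu
    have t1 : Tendsto (fun x : ℝ => x - x * u) atTop atTop := by
      have : (fun x : ℝ => x - x * u) = fun x => x * (1 - u) := by funext x; ring
      rw [this]
      exact tendsto_id.atTop_mul_const (by linarith [hu.2])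
    have t2 : Tendsto (fun x : ℝ => x * u) atTop atTop := tendsto_id.atTop_mul_const hu.1
    exact (hA.comp t1).mul (hB.comp t2)

/-- **Abel's theorem** for convolutions of conditionally convergent integrals. -/
theorem eq_mul_of_tendsto_primitive_realConv {φ ψ : ℝ → ℝ} {A B C : ℝ}
    (hφ : ∀ b, 0 ≤ b → IsRiemann φ b) (hψ : ∀ b, 0 ≤ b → IsRiemann ψ b)
    (hA : Tendsto (primitive φ) atTop (𝓝 A)) (hB : Tendsto (primitive ψ) atTop (𝓝 B))
    (hC : Tendsto (primitive (realConv φ ψ)) atTop (𝓝 C)) : C = A * B := by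
  have hφ' := fun b hb => (hφ b hb).primitive hb
  have hψ' := fun b hb => (hψ b hb).primitive hb
  have hD := fun b hb => ((hφ b hb).realConv hb (hψ b hb)).primitive hb
  -- Convolving with the constant 1 is integrating, so this is the Cesàro mean of the primitive.
  have t1 := tendsto_realConv_div (fun b _ => isRiemann_const 1 b) hD
    (tendsto_const_nhds (x := (1 : ℝ))) hC
  have t2 := tendsto_realConv_div hφ' hψ' hA hB
  rw [one_mul] at t1
  refine tendsto_nhds_unique t1 (t2.congr' ?_)
  filter_upwards [eventually_ge_atTop 0] with x hx
  -- Two uses of `primitive_realConv`, one for each factor, identify the double primitive of the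
  -- convolution with the convolution of the primitives.
  rw [realConv_one, realConv_comm, ← primitive_realConv hx (hψ x hx) (hφ' x hx)]
  congr 1
  refine intervalIntegral.integral_congr fun y hy => ?_
  rw [uIcc_of_le hx] at hy
  rw [primitive_realConv hy.1 (hφ y hy.1) (hψ y hy.1), realConv_comm]

/-- **Mertens' theorem** for convolutions. -/
theorem tendsto_primitive_realConv {φ ψ : ℝ → ℝ} {B : ℝ}
    (hφ : ∀ b, 0 ≤ b → IsRiemann φ b) (hψ : ∀ b, 0 ≤ b → IsRiemann ψ b)
    (habs : ∃ A, Tendsto (primitive fun s => |φ s|) atTop (𝓝 A))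
    (hB : Tendsto (primitive ψ) atTop (𝓝 B)) :
    ∃ C, Tendsto (primitive (realConv φ ψ)) atTop (𝓝 C) := by
  obtain ⟨A, hA⟩ := habs
  have hint : IntegrableOn φ (Ioi 0) := by
    refine integrableOn_Ioi_of_intervalIntegral_norm_tendsto A 0 (b := fun x : ℝ => max x 0)
      (fun x => (hφ _ (le_max_right _ _)).integrableOn (le_max_right _ _))
      (tendsto_atTop_mono (fun x => le_max_left x 0) tendsto_id) ?_
    refine hA.congr' ?_
    filter_upwards [eventually_ge_atTop 0] with x hx
    simp [max_eq_left hx, primitive]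
  have hψ' := fun b hb => (hψ b hb).primitive hb
  obtain ⟨M, hM⟩ := exists_bound_of_tendsto hψ' hB
  -- For fixed `r`, the factor `primitive ψ (x - r)` tends to `B` and is bounded by `M`, so `M * |φ
  -- r|` dominates.
  refine ⟨∫ r in Ioi 0, B * φ r, ?_⟩
  have hrw : ∀ᶠ x : ℝ in atTop, ∫ r in Ioi 0, (Ioc 0 x).indicator
      (fun r => primitive ψ (x - r) * φ r) r = primitive (realConv φ ψ) x := by
    filter_upwards [eventually_ge_atTop 0] with x hx
    have hcomm : primitive (realConv φ ψ) x = primitive (realConv ψ φ) x :=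
      intervalIntegral.integral_congr fun y _ => realConv_comm φ ψ y
    rw [hcomm, primitive_realConv hx (hψ x hx) (hφ x hx), realConv,
      intervalIntegral.integral_of_le hx, setIntegral_indicator measurableSet_Ioc,
      inter_eq_right.2 Ioc_subset_Ioi_self]
  refine Tendsto.congr' hrw ?_
  refine tendsto_integral_filter_of_dominated_convergence (fun r => M * |φ r|) ?_ ?_
    (hint.abs.const_mul M) ?_
  · filter_upwards [eventually_ge_atTop 0] with x hx
    have h := ((hψ' x hx).comp_sub_left.mul (hφ x hx)).aestronglyMeasurable hx
    exact ((aestronglyMeasurable_indicator_iff measurableSet_Ioc).2 h).restrict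
  · filter_upwards with x
    filter_upwards with r
    by_cases hr : r ∈ Ioc 0 x
    · rw [indicator_of_mem hr, Real.norm_eq_abs, abs_mul]
      exact mul_le_mul_of_nonneg_right (hM _ (by linarith [hr.2])) (abs_nonneg _)
    · rw [indicator_of_notMem hr, norm_zero]
      exact mul_nonneg ((abs_nonneg _).trans (hM 0 le_rfl)) (abs_nonneg _)
  · filter_upwards [ae_restrict_mem measurableSet_Ioi] with r hr
    have hr : 0 < r := hr
    have t : Tendsto (fun x : ℝ => x - r) atTop atTop := tendsto_atTop_add_const_right _ _ tendsto_id
    refine ((hB.comp t).mul_const (φ r)).congr' ?_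
    filter_upwards [eventually_ge_atTop r] with x hx
    exact (indicator_of_mem (show r ∈ Ioc (0 : ℝ) x from ⟨hr, hx⟩)
      (fun r => primitive ψ (x - r) * φ r)).symm

/-! ### Exponential kernels and the convolution theorem -/

/-- By the intermediate value theorem every `y ≥ S a` is attained at some `t ≥ a`. Equality of
filters, rather than mere divergence, lets limits along `S(b)` be read as limits along all reals. -/
theorem map_atTop_of_continuous {S : ℝ → ℝ} (hcont : Continuous S)
    (htop : Tendsto S atTop atTop) : map S atTop = atTop := by
  refine le_antisymm htop fun s hs => ?_
  obtain ⟨a, ha⟩ := mem_atTop_sets.1 hs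
  refine mem_atTop_sets.2 ⟨S a, fun y hy => ?_⟩
  obtain ⟨b, hb, hab⟩ := ((htop.eventually_ge_atTop y).and (eventually_ge_atTop a)).exists
  obtain ⟨t, ht, rfl⟩ := intermediate_value_Icc hab hcont.continuousOn ⟨hy, hb⟩
  exact ha t ht.1

/-- The integrand `e^{-p S(t)} h(t)` common to the Laplace and the Sumudu transform. -/
noncomputable def expIntegrand (F : Set ℝ) (α l p : ℝ) (h : ℝ → ℝ) (t : ℝ) : ℝ :=
  Real.exp (-(p * staircase F α l t)) * h t

theorem sumuduIntegrand_eq (F : Set ℝ) (α l : ℝ) (h : ℝ → ℝ) (v : ℝ) :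
    sumuduIntegrand F α l h v = expIntegrand F α l (staircase F α l v)⁻¹ h := by
  funext t
  rw [sumuduIntegrand, expIntegrand, div_eq_inv_mul]

theorem exp_mul_realConv (p : ℝ) (f g : ℝ → ℝ) (x : ℝ) :
    Real.exp (-(p * x)) * realConv f g x =
      realConv (fun s => Real.exp (-(p * s)) * f s) (fun s => Real.exp (-(p * s)) * g s) x := by
  rw [realConv, realConv, ← intervalIntegral.integral_const_mul]
  congr 1
  funext r
  have : Real.exp (-(p * x)) = Real.exp (-(p * (x - r))) * Real.exp (-(p * r)) := by
    rw [← Real.exp_add]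
    ring_nf
  rw [this]
  ring

theorem IsRiemann.of_exp_mul {p b : ℝ} {f : ℝ → ℝ}
    (h : IsRiemann (fun s => Real.exp (-(p * s)) * f s) b) : IsRiemann f b := by
  have h1 : IsRiemann (fun s => Real.exp (p * s)) b :=
    IsRiemann.of_continuous_eqOn (by fun_prop) fun _ _ => rfl
  have h2 := h1.mul h
  simpa only [← mul_assoc, ← Real.exp_add, add_neg_cancel, Real.exp_zero, one_mul] using h2

section Staircase

variable {F : Set ℝ} (hF : IsClosed F) {α : ℝ} (hα : 0 < α) {l : ℝ}
  (hfin : ∀ x y : ℝ, x ≤ y → mass F α x y ≠ ⊤) (hzero : staircase F α l 0 = 0)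
  (htop : Tendsto (staircase F α l) atTop atTop)

include hα hfin hzero htop in
theorem exists_staircase_eq {s : ℝ} (hs : 0 ≤ s) : ∃ t, 0 ≤ t ∧ staircase F α l t = s := by
  obtain ⟨b, hb, h0⟩ := ((htop.eventually_ge_atTop s).and (eventually_ge_atTop 0)).exists
  obtain ⟨t, ht, hts⟩ := intermediate_value_Icc h0
    (continuous_staircase (F := F) hα l hfin).continuousOn ⟨hzero.symm ▸ hs, hb⟩
  exact ⟨t, ht.1, hts⟩

include hF hα hfin hzero htop in
theorem tendsto_integral_iff {h φ : ℝ → ℝ} (hh : ∀ t, 0 ≤ t → h t = φ (staircase F α l t))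
    (hφ : ∀ b, 0 ≤ b → IsRiemann φ b) {I : ℝ} :
    Tendsto (fun b => integral F α l h 0 b) atTop (𝓝 I) ↔
      Tendsto (primitive φ) atTop (𝓝 I) := by
  have hcont := continuous_staircase (F := F) hα l hfin
  conv_rhs => rw [← map_atTop_of_continuous hcont htop, tendsto_map'_iff]
  refine tendsto_congr' ?_
  filter_upwards [eventually_ge_atTop 0] with b hb
  exact integral_eq_intervalIntegral hF hα hfin hzero hh hb
    (hφ _ (hzero ▸ monotone_staircase hα l hfin hb))

include hF hα hfin hzero htop in
theorem improperIntegrable_iff {h φ : ℝ → ℝ} (hh : ∀ t, 0 ≤ t → h t = φ (staircase F α l t)) :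
    ImproperIntegrable F α l h ↔
      (∀ b, 0 ≤ b → IsRiemann φ b) ∧ ∃ I, Tendsto (primitive φ) atTop (𝓝 I) := by
  have hiff : (∀ b, 0 ≤ b → Integrable F α l h 0 b) ↔ ∀ b, 0 ≤ b → IsRiemann φ b := by
    constructor
    · intro H s hs
      obtain ⟨t, ht, rfl⟩ := exists_staircase_eq hα hfin hzero htop hs
      exact (integrable_iff_isRiemann hF hα hfin hzero hh ht).1 (H t ht)
    · intro H b hb
      exact (integrable_iff_isRiemann hF hα hfin hzero hh hb).2
        (H _ (hzero ▸ monotone_staircase hα l hfin hb))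
  rw [ImproperIntegrable, hiff]
  refine and_congr_right fun hφ => exists_congr fun I => ?_
  exact tendsto_integral_iff hF hα hfin hzero htop hh hφ

include hF hα hfin hzero htop in
theorem improperIntegral_eq {h φ : ℝ → ℝ} (hh : ∀ t, 0 ≤ t → h t = φ (staircase F α l t))
    (hφ : ∀ b, 0 ≤ b → IsRiemann φ b) {I : ℝ} (hI : Tendsto (primitive φ) atTop (𝓝 I)) :
    improperIntegral F α l h = I :=
  ((tendsto_integral_iff hF hα hfin hzero htop hh hφ).2 hI).limUnder_eq

include hF hα hfin hzero htop in
/-- The convolution theorem for the transform with kernel `e^{-p S(t)}`. -/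
theorem expTransform_conv (p : ℝ) (f g : ℝ → ℝ)
    (hf : ImproperIntegrable F α l (expIntegrand F α l p (onFractal F α l f)))
    (hg : ImproperIntegrable F α l (expIntegrand F α l p (onFractal F α l g))) :
    (∀ t, 0 ≤ t → Integrable F α l (convIntegrand F α l f g t) 0 t) ∧
    (ImproperIntegrable F α l (fun t => |expIntegrand F α l p (onFractal F α l f) t|) ∨
        ImproperIntegrable F α l (fun t => |expIntegrand F α l p (onFractal F α l g) t|) →
      ImproperIntegrable F α l (expIntegrand F α l p (conv F α l f g))) ∧
    (ImproperIntegrable F α l (expIntegrand F α l p (conv F α l f g)) →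
      improperIntegral F α l (expIntegrand F α l p (conv F α l f g)) =
        improperIntegral F α l (expIntegrand F α l p (onFractal F α l f)) *
          improperIntegral F α l (expIntegrand F α l p (onFractal F α l g))) := by
  set φ : ℝ → ℝ := fun s => Real.exp (-(p * s)) * f s
  set ψ : ℝ → ℝ := fun s => Real.exp (-(p * s)) * g s
  have hfφ : ∀ t, 0 ≤ t → expIntegrand F α l p (onFractal F α l f) t = φ (staircase F α l t) :=
    fun _ _ => rfl
  have hgψ : ∀ t, 0 ≤ t → expIntegrand F α l p (onFractal F α l g) t = ψ (staircase F α l t) :=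
    fun _ _ => rfl
  obtain ⟨hφ, A, hA⟩ := (improperIntegrable_iff hF hα hfin hzero htop hfφ).1 hf
  obtain ⟨hψ, B, hB⟩ := (improperIntegrable_iff hF hα hfin hzero htop hgψ).1 hg
  have hS : ∀ t, 0 ≤ t → 0 ≤ staircase F α l t := fun t ht =>
    hzero ▸ monotone_staircase hα l hfin ht
  -- Multiplying by `e^{ps}` removes the weights; a reflection and a product then give the
  -- convolution integrand.
  have hprod : ∀ t, 0 ≤ t → IsRiemann (fun r => f (staircase F α l t - r) * g r)
      (staircase F α l t) := fun t ht =>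
    (hφ _ (hS t ht)).of_exp_mul.comp_sub_left.mul (hψ _ (hS t ht)).of_exp_mul
  have hcψ : ∀ t, 0 ≤ t → expIntegrand F α l p (conv F α l f g) t =
      realConv φ ψ (staircase F α l t) := by
    intro t ht
    rw [← exp_mul_realConv, expIntegrand, conv,
      integral_eq_intervalIntegral hF hα hfin hzero (h := convIntegrand F α l f g t)
        (φ := fun r => f (staircase F α l t - r) * g r) (fun _ _ => rfl) ht (hprod t ht), realConv]
  have hc : ∀ b, 0 ≤ b → IsRiemann (realConv φ ψ) b := fun b hb => (hφ b hb).realConv hb (hψ b hb)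
  refine ⟨fun t ht => ?_, fun habs => ?_, fun hconv => ?_⟩
  · exact (integrable_iff_isRiemann hF hα hfin hzero
      (φ := fun r => f (staircase F α l t - r) * g r) (fun _ _ => rfl) ht).2 (hprod t ht)
  · refine (improperIntegrable_iff hF hα hfin hzero htop hcψ).2 ⟨hc, ?_⟩
    rcases habs with h | h
    · have := (improperIntegrable_iff hF hα hfin hzero htop (φ := fun s => |φ s|)
        fun _ _ => rfl).1 h
      exact tendsto_primitive_realConv hφ hψ this.2 hB
    · have := (improperIntegrable_iff hF hα hfin hzero htop (φ := fun s => |ψ s|)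
        fun _ _ => rfl).1 h
      have hcomm : realConv φ ψ = realConv ψ φ := funext fun x => realConv_comm φ ψ x
      rw [hcomm]
      exact tendsto_primitive_realConv hψ hφ this.2 hA
  · obtain ⟨_, C, hC⟩ := (improperIntegrable_iff hF hα hfin hzero htop hcψ).1 hconv
    rw [improperIntegral_eq hF hα hfin hzero htop hcψ hc hC,
      improperIntegral_eq hF hα hfin hzero htop hfφ hφ hA,
      improperIntegral_eq hF hα hfin hzero htop hgψ hψ hB]
    exact eq_mul_of_tendsto_primitive_realConv hφ hψ hA hB hC

end Staircase

end FractalCalculus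

theorem proposition2p23 (F : Set ℝ) (hF : IsClosed F) (α : ℝ) (hα₀ : 0 < α) (hα₁ : α ≤ 1) (l : ℝ)
    (hfin : ∀ x y : ℝ, x ≤ y → FractalCalculus.mass F α x y ≠ ⊤)
    (hzero : FractalCalculus.staircase F α l 0 = 0)
    (htop : Filter.Tendsto (FractalCalculus.staircase F α l) Filter.atTop Filter.atTop)
    (f g : ℝ → ℝ) (v : ℝ) :
    -- the Laplace transform of the convolution
    (FractalCalculus.LaplaceExists F α l (FractalCalculus.onFractal F α l f) v →
      FractalCalculus.LaplaceExists F α l (FractalCalculus.onFractal F α l g) v →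
      (∀ t, 0 ≤ t →
        FractalCalculus.Integrable F α l (FractalCalculus.convIntegrand F α l f g t) 0 t) ∧
      (FractalCalculus.LaplaceExistsAbs F α l (FractalCalculus.onFractal F α l f) v ∨
          FractalCalculus.LaplaceExistsAbs F α l (FractalCalculus.onFractal F α l g) v →
        FractalCalculus.LaplaceExists F α l (FractalCalculus.conv F α l f g) v) ∧
      (FractalCalculus.LaplaceExists F α l (FractalCalculus.conv F α l f g) v →
        FractalCalculus.laplace F α l (FractalCalculus.conv F α l f g) v =
          FractalCalculus.laplace F α l (FractalCalculus.onFractal F α l f) v *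
            FractalCalculus.laplace F α l (FractalCalculus.onFractal F α l g) v)) ∧
    -- the Sumudu transform of the convolution
    (FractalCalculus.staircase F α l v ≠ 0 →
      FractalCalculus.SumuduExists F α l (FractalCalculus.onFractal F α l f) v →
      FractalCalculus.SumuduExists F α l (FractalCalculus.onFractal F α l g) v →
      (∀ t, 0 ≤ t →
        FractalCalculus.Integrable F α l (FractalCalculus.convIntegrand F α l f g t) 0 t) ∧
      (FractalCalculus.SumuduExistsAbs F α l (FractalCalculus.onFractal F α l f) v ∨
          FractalCalculus.SumuduExistsAbs F α l (FractalCalculus.onFractal F α l g) v →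
        FractalCalculus.SumuduExists F α l (FractalCalculus.conv F α l f g) v) ∧
      (FractalCalculus.SumuduExists F α l (FractalCalculus.conv F α l f g) v →
        FractalCalculus.sumudu F α l (FractalCalculus.conv F α l f g) v =
          FractalCalculus.staircase F α l v *
            FractalCalculus.sumudu F α l (FractalCalculus.onFractal F α l f) v *
            FractalCalculus.sumudu F α l (FractalCalculus.onFractal F α l g) v)) := by
  refine ⟨fun hf hg => ?_, fun hv hf hg => ?_⟩
  -- The Laplace integrand is definitionally `expIntegrand` with `p = S(v)`.
  · obtain ⟨h1, h2, h3⟩ := FractalCalculus.expTransform_conv hF hα₀ hfin hzero htop _ f g hf hg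
    exact ⟨h1, fun h => h2 (h.imp And.right And.right), h3⟩
  · simp only [FractalCalculus.SumuduExists, FractalCalculus.SumuduExistsAbs,
      FractalCalculus.sumudu, FractalCalculus.sumuduIntegrand_eq] at hf hg ⊢
    obtain ⟨h1, h2, h3⟩ := FractalCalculus.expTransform_conv hF hα₀ hfin hzero htop _ f g hf hg
    refine ⟨h1, fun h => h2 (h.imp And.right And.right), fun h => ?_⟩
    rw [h3 h]
    -- Each Sumudu transform carries a factor `1 / S(v)`: one on the left against two on the right,
    -- which the extra `S(v)` balances.
    field_simp
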